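/- **Setting.** A heterogeneous task dependency graph (HTDG) has a finite set $T$ of tasks, a domain $d_t\in D$ ($D$ finite) for each task, a set of condition tasks, and for each task an ordered finite list of successors. Edges leaving condition tasks are *weak* dependencies, all others are *strong*; cycles are allowed. *Task-level scheduling*: initially the tasks without any (strong or weak) dependency are ready. When a ready task is executed, its counter of remaining strong dependencies is re-armed to its number of strong dependencies; if it is a condition task returning the index $r$, its $r$-th successor (if there is one) becomes ready; otherwise one strong dependency is removed, one at a time, from each of its successors, and a successor whose counter thereby becomes $0$ becomes ready. The execution is *complete* when no task is ready and no such removal is outstanding. **Scheduler.** There is a finite set $W$ of workers, worker $w$ having domain $d_w$, and each domain of a task has at least one worker. Each worker has one local queue per domain, and there is one shared queue per domain. Owners push and pop at one end, thieves steal at the other. Each domain $d$ has atomic counters $\mathrm{actives}[d]$, $\mathrm{thieves}[d]$ (initially $0$) and an event notifier: `prepare_wait` makes a worker waiting; `notify_one` notifies an arbitrary waiting, not yet notified worker of the domain, if there is one; `cancel_wait` ends the waiting; `commit_wait` blocks until the worker is notified. With a local variable $t$ (initially NIL), each worker $w$ of domain $d=d_w$ repeats `exploit_task`, `wait_for_task`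 until the latter returns false: * `exploit_task`: if $t\ne$ NIL: if AtomInc$(\mathrm{actives}[d])=1$ and then $\mathrm{thieves}[d]=0$, notify_one$(d)$; do {`execute_task`; pop $t$ from $w$'s local queue for $d$} while $t\neq$ NIL; AtomDec$(\mathrm{actives}[d])$. * `execute_task`: run $t$; re-arm its counter; if it is a condition task, `submit_task` the selected successor; otherwise, for each successor $s$, AtomDec its counter and, if the result is $0$, `submit_task`$(s)$. * `submit_task`$(s)$: push $s$ into $w$'s local queue for $d_s$; if $d_s\ne d$ and $\mathrm{actives}[d_s]=0$ and then $\mathrm{thieves}[d_s]=0$, notify_one$(d_s)$. * `wait_for_task`: (1) AtomInc$(\mathrm{thieves}[d])$. (2) `explore_task`: while $t=$ NIL, make at most MAX_STEAL attempts to steal a task of domain $d$ from a random victim (the shared queue or another worker). (3) If $t\ne$ NIL: if AtomDec$(\mathrm{thieves}[d])=0$, notify_one$(d)$; return true. (4) `prepare_wait`. (5) If the shared queue for $d$ is nonempty: `cancel_wait`, steal $t$ from it; if $t\neq$ NIL continue as in (3), otherwise go to (2). (6) If the stop signal is set: `cancel_wait`, notify all workers of all domains, AtomDec$(\mathrm{thieves}[d])$,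 return false. (7) If AtomDec$(\mathrm{thieves}[d])=0$ and either $\mathrm{actives}[d]>0$ or then, inspecting them one by one, some worker's local queue for $d$ is found nonempty: `cancel_wait`, go to (1). (8) `commit_wait`; return true. An external thread executes `submit_graph`: for each task without dependencies, in any order, push it into the shared queue of its domain, then notify_one for this domain. A *run* is an arbitrary interleaving of the atomic actions of all these threads (each queue, counter and notifier operation, and each execution of a task, is atomic) from the initial state. It is *fair* if a thread that can act from some time on eventually acts. Condition tasks may return arbitrary indices. For each worker, the victims of its successive steal attempts are independent and uniformly distributed over the shared queue and the other workers, and MAX_STEAL $\ge 1$. **Theorem.** Almost surely with respect to the random victims, every fair run in which the stop signal is never raised correctly executes the HTDG: 1. The run follows task-level scheduling: if the ready tasks are those not yet pushed by the external thread, those in shared or local queues, those held by a worker and not yet run, and those that a worker is about to push, then the run starts in the initial state of task-level scheduling, and each of its actions either leaves the task-level state unchanged or is a legal step of task-level scheduling. In particular no task is lost or executed more often than it was submitted. 2. No task parallelism goes undetected: whenever a task of domain $d$ is ready (in particular, is in a shared queue, or in a local queue of a worker of any domain), a task of domain $d$ is executed later. 3. If the control flow is finite (the total number of task executions in the run is finite),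 then every submitted task is eventually executed, and from some time on the execution of the HTDG is complete. 4. The control flow is finite whenever every cycle of the HTDG contains a condition task and condition tasks are executed only finitely often in the run. 5. If the HTDG is acyclic and has no condition tasks, then eventually every task has been executed exactly once, and at no time has a task been executed before one of its predecessors. -/

import Mathlib

open MeasureTheory ProbabilityTheory

namespace WorkStealing

/-! ### Heterogeneous task dependency graphs and task-level scheduling -/

/-- A heterogeneous task dependency graph (HTDG) on tasks `T` and domains `D`: every task has a
domain (e.g. CPU, GPU), is or is not a condition task, and has an ordered list of successors.
Edges out of condition tasks are weak dependencies, all the other edges are strong ones.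
Cycles are allowed. -/
structure HTDG (T D : Type*) where
  domain : T → D
  isCond : T → Bool
  succ : T → List T

section Graph

variable {T D : Type*}

/-- `p → t` is a strong dependency. -/
def HTDG.StrongEdge (g : HTDG T D) (p t : T) : Prop :=
  g.isCond p = false ∧ t ∈ g.succ p

/-- No cycle consists of strong dependencies only: every cycle of the graph passes through a
condition task. -/
def HTDG.StronglyAcyclic (g : HTDG T D) : Prop :=
  ∀ t, ¬ Relation.TransGen g.StrongEdge t t

/-- The successor that a condition task jumps to when its callable returns `r` (an index that
points to no successor selects nothing); tasks that are not condition tasks select nothing. -/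
def HTDG.chosen (g : HTDG T D) (t : T) (r : ℕ) : Option T :=
  if g.isCond t then (g.succ t)[r]? else none

variable [Fintype T] [DecidableEq T]

/-- The number of strong dependencies of `t`. -/
def HTDG.numStrong (g : HTDG T D) (t : T) : ℕ :=
  ∑ p, if g.isCond p then 0 else (g.succ p).count t

/-- The tasks without any dependency, strong or weak. -/
def HTDG.sources (g : HTDG T D) : Finset T :=
  Finset.univ.filter fun t => ∀ p, t ∉ g.succ p

end Graph

/-- State of the task-level scheduling of an HTDG. -/
structure TaskState (T : Type*) where
  /-- tasks that have to be executed (with multiplicity) and whose execution has not happened -/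
  ready : Multiset T
  /-- `s` occurs here once for each strong dependency `p → s` such that `p` has been executed but
  the dependency has not been removed from `s` yet -/
  releasing : Multiset T
  /-- remaining strong dependencies -/
  counter : T → ℤ
  /-- number of executions so far -/
  executed : T → ℕ

section TaskLevel

variable {T D : Type*} [Fintype T] [DecidableEq T]

/-- Scheduling starts with the tasks of zero dependencies. -/
def TaskState.init (g : HTDG T D) : TaskState T where
  ready := g.sources.val
  releasing := 0
  counter t := g.numStrong t
  executed _ := 0

/-- One step of task-level scheduling: either a ready task is executed once (a condition task makes
the successor that it selects ready; any other task starts to release its successors), or one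
strong dependency is removed from a task, which becomes ready if no strong dependency remains. -/
inductive TaskStep (g : HTDG T D) : TaskState T → TaskState T → Prop
  | execute (σ : TaskState T) (t : T) (r : ℕ) (h : t ∈ σ.ready) :
      TaskStep g σ
        { ready := σ.ready.erase t + (g.chosen t r).elim 0 (fun y => {y})
          releasing := σ.releasing + (if g.isCond t then 0 else (g.succ t : Multiset T))
          counter := Function.update σ.counter t (g.numStrong t : ℤ)
          executed := Function.update σ.executed t (σ.executed t + 1) }
  | release (σ : TaskState T) (x : T) (h : x ∈ σ.releasing) :
      TaskStep g σ
        { ready := σ.ready + (if σ.counter x - 1 = 0 then {x} else 0)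
          releasing := σ.releasing.erase x
          counter := Function.update σ.counter x (σ.counter x - 1)
          executed := σ.executed }

/-- Nothing is left to do. -/
def TaskState.Complete (σ : TaskState T) : Prop := σ.ready = 0 ∧ σ.releasing = 0

end TaskLevel

/-! ### The scheduler -/

/-- The scheduler's parameters: the domain of each worker, the HTDG to be executed, and the bound on
the number of steal attempts per call of `explore_task`. -/
structure System (W D T : Type*) where
  workerDomain : W → D
  graph : HTDG T D
  maxSteal : ℕ

/-- Control locations of a worker. Every location stands for one atomic action. -/
inductive PC (W D T : Type*)
  /-- `exploit_task`: test `t ≠ NIL` and, if so, `AtomInc(actives[d_w])` -/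
  | exploit
  /-- `exploit_task`: test `thieves[d_w] == 0` -/
  | exploitReadThieves
  /-- `exploit_task`: `notifier[d_w].notify_one()` -/
  | exploitNotify
  /-- `execute_task`: run the callable of `t` -/
  | invoke
  /-- `execute_task`: loop over the successors, `rest` is still to be treated -/
  | release (rest : List T)
  /-- `submit_task(w, x)`: push `x`; then go on with `rest` -/
  | push (x : T) (rest : List T)
  /-- `submit_task`: test `actives[d] == 0` -/
  | submitReadActives (d : D) (rest : List T)
  /-- `submit_task`: test `thieves[d] == 0` -/
  | submitReadThieves (d : D) (rest : List T)
  /-- `submit_task`: `notifier[d].notify_one()` -/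
  | submitNotify (d : D) (rest : List T)
  /-- `exploit_task`: `t ← w.task_queue[d_w].pop()` and loop test -/
  | pop
  /-- `exploit_task`: `AtomDec(actives[d_w])` -/
  | decActives
  /-- `wait_for_task`, first action: `AtomInc(thieves[d_w])` -/
  | incThieves
  /-- `explore_task`, `steals` attempts have been made -/
  | explore (steals : ℕ)
  /-- `wait_for_task`, `t ≠ NIL`: test `AtomDec(thieves[d_w]) == 0` -/
  | leave
  /-- `wait_for_task`, `t ≠ NIL`: `notifier[d_w].notify_one()` -/
  | leaveNotify
  /-- `wait_for_task`: `prepare_wait(w)` -/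
  | prepare
  /-- `wait_for_task`: test whether the shared queue is empty -/
  | checkShared
  /-- `wait_for_task`: `cancel_wait(w)` as the shared queue is nonempty -/
  | cancelShared
  /-- `wait_for_task`: steal from the shared queue -/
  | stealShared
  /-- `wait_for_task`: test `stop` -/
  | checkStop
  /-- `wait_for_task`, `stop`: `cancel_wait(w)` -/
  | stopCancel
  /-- `wait_for_task`, `stop`: `notify_all` for the domains in `rest` -/
  | stopNotify (rest : Finset D)
  /-- `wait_for_task`, `stop`: `AtomDec(thieves[d_w])`, return false -/
  | stopDec
  /-- `wait_for_task`: test `AtomDec(thieves[d_w]) == 0` -/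
  | lastThief
  /-- `wait_for_task`, last thief: test `actives[d_w] > 0` -/
  | checkActives
  /-- `wait_for_task`, last thief: inspect the queues of the workers in `rest` -/
  | scan (rest : Finset W)
  /-- `wait_for_task`, last thief: `cancel_wait(w)`, start `wait_for_task` again -/
  | cancelRetry
  /-- `wait_for_task`: `commit_wait(w)` -/
  | commit
  /-- the worker has left `worker_loop` -/
  | exited

section PC

variable {W D T : Type*}

/-- The task about to be pushed. -/
def PC.pushing : PC W D T → Multiset T
  | .push x _ => {x}
  | _ => 0

/-- The successors still to be treated by the loop of `execute_task`. -/
def PC.releasing : PC W D T → Multiset T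
  | .release l => l
  | .push _ l => l
  | .submitReadActives _ l => l
  | .submitReadThieves _ l => l
  | .submitNotify _ l => l
  | _ => 0

end PC

/-- Status of a worker at the event notifier of its domain: not waiting; waiting (from
`prepare_wait` on, before or after `commit_wait`); or waiting and already notified. -/
inductive Wait
  | idle
  | waiting
  | notified

/-- Global state of the scheduler. In all queues, tasks are pushed at the head; the owner pops at
the head and thieves steal at the other end. -/
structure State (W D T : Type*) where
  /-- `shared d` is the shared task queue of domain `d` -/
  shared : D → List T
  /-- `queue w d` is the local task queue of worker `w` for domain `d` -/
  queue : W → D → List T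
  actives : D → ℤ
  thieves : D → ℤ
  /-- strong dependents counters of the tasks -/
  counter : T → ℤ
  /-- number of executions of each task so far (a history variable) -/
  executed : T → ℕ
  stopSignal : Bool
  pc : W → PC W D T
  /-- the per-worker global `t`; it is cleared when the callable of the task is run -/
  task : W → Option T
  wait : W → Wait
  /-- number of steal attempts of each worker so far, i.e. the position in its random sequence -/
  attempts : W → ℕ
  /-- `submit_graph`: source tasks that the external thread still has to push -/
  toSubmit : List T
  /-- `submit_graph`: domain that the external thread has to notify next -/
  toNotify : Option D

section Semantics

variable {W D T : Type*} [DecidableEq W]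

/-- Worker `w` moves to location `c`. -/
def State.goto (s : State W D T) (w : W) (c : PC W D T) : State W D T :=
  { s with pc := Function.update s.pc w c }

/-- `t ← o` for worker `w`. -/
def State.setTask (s : State W D T) (w : W) (o : Option T) : State W D T :=
  { s with task := Function.update s.task w o }

/-- The notifier status of `w` becomes `x`. -/
def State.setWait (s : State W D T) (w : W) (x : Wait) : State W D T :=
  { s with wait := Function.update s.wait w x }

/-- The local queue of `x` for domain `d` becomes `q`. -/
def State.setQueue [DecidableEq D] (s : State W D T) (x : W) (d : D) (q : List T) : State W D T :=
  { s with queue := Function.update s.queue x (Function.update (s.queue x) d q) }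

/-- The shared queue of domain `d` becomes `q`. -/
def State.setShared [DecidableEq D] (s : State W D T) (d : D) (q : List T) : State W D T :=
  { s with shared := Function.update s.shared d q }

/-- Add `i` to `actives[d]`. -/
def State.addActives [DecidableEq D] (s : State W D T) (d : D) (i : ℤ) : State W D T :=
  { s with actives := Function.update s.actives d (s.actives d + i) }

/-- Add `i` to `thieves[d]`. -/
def State.addThieves [DecidableEq D] (s : State W D T) (d : D) (i : ℤ) : State W D T :=
  { s with thieves := Function.update s.thieves d (s.thieves d + i) }

/-- `notifier[d].notify_one()`: if some worker of domain `d` is waiting and not yet notified, an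
arbitrary such worker is notified; otherwise there is no effect. -/
inductive NotifyOne (S : System W D T) (d : D) (s : State W D T) : State W D T → Prop
  | wake (w : W) (hd : S.workerDomain w = d) (hw : s.wait w = .waiting) :
      NotifyOne S d s (s.setWait w .notified)
  | nobody (h : ∀ w, S.workerDomain w = d → s.wait w ≠ .waiting) : NotifyOne S d s s

/-- The effect of `notifier[d].notify_all()`. -/
def State.notifyAll [DecidableEq D] (S : System W D T) (d : D) (s : State W D T) : State W D T :=
  { s with wait := fun w =>
      match s.wait w with
      | .waiting => if S.workerDomain w = d then .notified else .waiting
      | x => x }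

variable [DecidableEq D] [Fintype W] [Fintype D] [Fintype T] [DecidableEq T]

/-- The atomic actions of worker `w`. The `k`-th steal attempt of `w` goes to the victim
`victim w k`, where `none` stands for the shared queue and `some x` for worker `x`. -/
inductive WorkerStep (S : System W D T) (victim : W → ℕ → Option W) (w : W)
    (s : State W D T) : State W D T → Prop
  -- `exploit_task`
  | exploitNil (h : s.pc w = .exploit) (ht : s.task w = none) :
      WorkerStep S victim w s (s.goto w .incThieves)
  | exploitInc (t : T) (h : s.pc w = .exploit) (ht : s.task w = some t) :
      WorkerStep S victim w s
        ((s.addActives (S.workerDomain w) 1).goto w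
          (if s.actives (S.workerDomain w) + 1 = 1 then .exploitReadThieves else .invoke))
  | exploitReadThieves (h : s.pc w = .exploitReadThieves) :
      WorkerStep S victim w s
        (s.goto w (if s.thieves (S.workerDomain w) = 0 then .exploitNotify else .invoke))
  | exploitNotify (s' : State W D T) (h : s.pc w = .exploitNotify)
      (hn : NotifyOne S (S.workerDomain w) s s') :
      WorkerStep S victim w s (s'.goto w .invoke)
  | pop (h : s.pc w = .pop) :
      WorkerStep S victim w s
        (((s.setQueue w (S.workerDomain w) (s.queue w (S.workerDomain w)).tail).setTask w
          (s.queue w (S.workerDomain w)).head?).goto w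
          (if s.queue w (S.workerDomain w) = [] then .decActives else .invoke))
  | decActives (h : s.pc w = .decActives) :
      WorkerStep S victim w s ((s.addActives (S.workerDomain w) (-1)).goto w .incThieves)
  -- `execute_task`: the callable of `t` is run and returns `r`; the dependency counter of `t` is
  -- re-armed for the next execution of `t`
  | invoke (t : T) (r : ℕ) (h : s.pc w = .invoke) (ht : s.task w = some t) :
      WorkerStep S victim w s
        (({ s with
            counter := Function.update s.counter t (S.graph.numStrong t : ℤ)
            executed := Function.update s.executed t (s.executed t + 1) }.setTask w none).goto w
          (if S.graph.isCond t then
            (match S.graph.chosen t r with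
              | some y => .push y []
              | none => .pop)
           else .release (S.graph.succ t)))
  | releaseDone (h : s.pc w = .release []) : WorkerStep S victim w s (s.goto w .pop)
  | releaseNext (x : T) (l : List T) (h : s.pc w = .release (x :: l)) :
      WorkerStep S victim w s
        ({ s with counter := Function.update s.counter x (s.counter x - 1) }.goto w
          (if s.counter x - 1 = 0 then .push x l else .release l))
  -- `submit_task`
  | push (x : T) (l : List T) (h : s.pc w = .push x l) :
      WorkerStep S victim w s
        ((s.setQueue w (S.graph.domain x) (x :: s.queue w (S.graph.domain x))).goto w
          (if S.workerDomain w = S.graph.domain x then .release l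
           else .submitReadActives (S.graph.domain x) l))
  | submitReadActives (d : D) (l : List T) (h : s.pc w = .submitReadActives d l) :
      WorkerStep S victim w s
        (s.goto w (if s.actives d = 0 then .submitReadThieves d l else .release l))
  | submitReadThieves (d : D) (l : List T) (h : s.pc w = .submitReadThieves d l) :
      WorkerStep S victim w s
        (s.goto w (if s.thieves d = 0 then .submitNotify d l else .release l))
  | submitNotify (d : D) (l : List T) (s' : State W D T) (h : s.pc w = .submitNotify d l)
      (hn : NotifyOne S d s s') :
      WorkerStep S victim w s (s'.goto w (.release l))
  -- `wait_for_task` and `explore_task`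
  | incThieves (h : s.pc w = .incThieves) :
      WorkerStep S victim w s ((s.addThieves (S.workerDomain w) 1).goto w (.explore 0))
  | attemptShared (k : ℕ) (h : s.pc w = .explore k) (ht : s.task w = none) (hk : k < S.maxSteal)
      (hv : victim w (s.attempts w) = none) :
      WorkerStep S victim w s
        (({ s with attempts := Function.update s.attempts w (s.attempts w + 1) }.setShared
            (S.workerDomain w) (s.shared (S.workerDomain w)).dropLast).setTask w
            (s.shared (S.workerDomain w)).getLast? |>.goto w (.explore (k + 1)))
  | attemptWorker (k : ℕ) (x : W) (h : s.pc w = .explore k) (ht : s.task w = none)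
      (hk : k < S.maxSteal) (hv : victim w (s.attempts w) = some x) :
      WorkerStep S victim w s
        (({ s with attempts := Function.update s.attempts w (s.attempts w + 1) }.setQueue x
            (S.workerDomain w) (s.queue x (S.workerDomain w)).dropLast).setTask w
            (s.queue x (S.workerDomain w)).getLast? |>.goto w (.explore (k + 1)))
  | exploreSuccess (k : ℕ) (t : T) (h : s.pc w = .explore k) (ht : s.task w = some t) :
      WorkerStep S victim w s (s.goto w .leave)
  | exploreFail (k : ℕ) (h : s.pc w = .explore k) (ht : s.task w = none) (hk : S.maxSteal ≤ k) :
      WorkerStep S victim w s (s.goto w .prepare)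
  | leave (h : s.pc w = .leave) :
      WorkerStep S victim w s
        ((s.addThieves (S.workerDomain w) (-1)).goto w
          (if s.thieves (S.workerDomain w) - 1 = 0 then .leaveNotify else .exploit))
  | leaveNotify (s' : State W D T) (h : s.pc w = .leaveNotify)
      (hn : NotifyOne S (S.workerDomain w) s s') :
      WorkerStep S victim w s (s'.goto w .exploit)
  | prepare (h : s.pc w = .prepare) :
      WorkerStep S victim w s ((s.setWait w .waiting).goto w .checkShared)
  | checkShared (h : s.pc w = .checkShared) :
      WorkerStep S victim w s
        (s.goto w (if s.shared (S.workerDomain w) = [] then .checkStop else .cancelShared))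
  | cancelShared (h : s.pc w = .cancelShared) :
      WorkerStep S victim w s ((s.setWait w .idle).goto w .stealShared)
  | stealShared (h : s.pc w = .stealShared) :
      WorkerStep S victim w s
        (((s.setShared (S.workerDomain w) (s.shared (S.workerDomain w)).dropLast).setTask w
          (s.shared (S.workerDomain w)).getLast?).goto w
          (if s.shared (S.workerDomain w) = [] then .explore 0 else .leave))
  | checkStop (h : s.pc w = .checkStop) :
      WorkerStep S victim w s (s.goto w (if s.stopSignal then .stopCancel else .lastThief))
  | stopCancel (h : s.pc w = .stopCancel) :
      WorkerStep S victim w s ((s.setWait w .idle).goto w (.stopNotify Finset.univ))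
  | stopNotify (d : D) (l : Finset D) (h : s.pc w = .stopNotify l) (hd : d ∈ l) :
      WorkerStep S victim w s ((s.notifyAll S d).goto w (.stopNotify (l.erase d)))
  | stopNotified (h : s.pc w = .stopNotify ∅) : WorkerStep S victim w s (s.goto w .stopDec)
  | stopDec (h : s.pc w = .stopDec) :
      WorkerStep S victim w s ((s.addThieves (S.workerDomain w) (-1)).goto w .exited)
  | lastThief (h : s.pc w = .lastThief) :
      WorkerStep S victim w s
        ((s.addThieves (S.workerDomain w) (-1)).goto w
          (if s.thieves (S.workerDomain w) - 1 = 0 then .checkActives else .commit))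
  | checkActives (h : s.pc w = .checkActives) :
      WorkerStep S victim w s
        (s.goto w (if 0 < s.actives (S.workerDomain w) then .cancelRetry else .scan Finset.univ))
  | scanNext (x : W) (l : Finset W) (h : s.pc w = .scan l) (hx : x ∈ l) :
      WorkerStep S victim w s
        (s.goto w (if s.queue x (S.workerDomain w) = [] then .scan (l.erase x) else .cancelRetry))
  | scanDone (h : s.pc w = .scan ∅) : WorkerStep S victim w s (s.goto w .commit)
  | cancelRetry (h : s.pc w = .cancelRetry) :
      WorkerStep S victim w s ((s.setWait w .idle).goto w .incThieves)
  -- `commit_wait` blocks until the worker has been notified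
  | commit (h : s.pc w = .commit) (hw : s.wait w = .notified) :
      WorkerStep S victim w s ((s.setWait w .idle).goto w .exploit)

/-- The atomic actions of the external thread that calls `submit_graph`: push a source task into the
shared queue of its domain, then notify that domain. -/
inductive SubmitStep (S : System W D T) (s : State W D T) : State W D T → Prop
  | push (t : T) (l : List T) (h : s.toSubmit = t :: l) (hn : s.toNotify = none) :
      SubmitStep S s
        { s.setShared (S.graph.domain t) (t :: s.shared (S.graph.domain t)) with
          toSubmit := l
          toNotify := some (S.graph.domain t) }
  | notify (d : D) (s' : State W D T) (h : s.toNotify = some d) (hn : NotifyOne S d s s') :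
      SubmitStep S s { s' with toNotify := none }

/-- Steps of the environment: nothing happens, or the executor raises the stop signal. -/
inductive EnvStep (s : State W D T) : State W D T → Prop
  | skip : EnvStep s s
  | raiseStop : EnvStep s { s with stopSignal := true }

/-- The threads of the system. -/
inductive Thread (W : Type*)
  | worker (w : W)
  | submitter

/-- The atomic actions of a thread. -/
def ThreadStep (S : System W D T) (victim : W → ℕ → Option W) :
    Thread W → State W D T → State W D T → Prop
  | .worker w => WorkerStep S victim w
  | .submitter => SubmitStep S

/-- Initial states: the workers have just been spawned, all queues are empty, and the external thread
is about to submit the source tasks, in any order. -/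
structure State.Initial (S : System W D T) (s : State W D T) : Prop where
  shared : ∀ d, s.shared d = []
  queue : ∀ w d, s.queue w d = []
  actives : ∀ d, s.actives d = 0
  thieves : ∀ d, s.thieves d = 0
  counter : ∀ t, s.counter t = S.graph.numStrong t
  executed : ∀ t, s.executed t = 0
  stopSignal : s.stopSignal = false
  pc : ∀ w, s.pc w = .exploit
  task : ∀ w, s.task w = none
  wait : ∀ w, s.wait w = .idle
  attempts : ∀ w, s.attempts w = 0
  toSubmit : (s.toSubmit : Multiset T) = S.graph.sources.val
  toNotify : s.toNotify = none

/-- `s` is an execution of the scheduler: an arbitrary interleaving of the atomic actions of the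
threads, where `θ n` is the thread that makes the `n`-th step (`none`: the environment). -/
structure IsRun (S : System W D T) (victim : W → ℕ → Option W) (s : ℕ → State W D T)
    (θ : ℕ → Option (Thread W)) : Prop where
  initial : (s 0).Initial S
  thread : ∀ n i, θ n = some i → ThreadStep S victim i (s n) (s (n + 1))
  env : ∀ n, θ n = none → EnvStep (s n) (s (n + 1))

/-- Weak fairness: a thread that can make a step from some time on eventually makes a step. -/
def IsFair (S : System W D T) (victim : W → ℕ → Option W) (s : ℕ → State W D T)
    (θ : ℕ → Option (Thread W)) : Prop :=
  ∀ i n, (∀ m, n ≤ m → ∃ s', ThreadStep S victim i (s m) s') → ∃ m, n ≤ m ∧ θ m = some i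

/-- The task-level state that a scheduler state represents. The ready tasks are those not yet pushed
by the external thread, those in the shared and the local queues, those held by a worker that has
not run them yet, and those that a worker is about to push. -/
def State.toTaskState (s : State W D T) : TaskState T where
  ready := (s.toSubmit : Multiset T) + (∑ d, (s.shared d : Multiset T))
    + (∑ w, ∑ d, (s.queue w d : Multiset T)) + (∑ w, (s.task w).elim 0 (fun t => {t}))
    + ∑ w, (s.pc w).pushing
  releasing := ∑ w, (s.pc w).releasing
  counter := s.counter
  executed := s.executed

/-- The steal victims are random: for each worker `w`, the victims of its successive attempts are
independent and uniformly distributed over the shared queue (`none`) and the other workers. -/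
structure RandomVictims {Ω : Type*} [MeasurableSpace Ω] (P : Measure Ω)
    (V : W → ℕ → Ω → Option W) : Prop where
  measurable : ∀ w k, Measurable[_, ⊤] (V w k)
  indep : ∀ w, iIndepFun (m := fun _ => ⊤) (V w) P
  uniform : ∀ w k v, v ≠ some w → P {ω | V w k ω = v} = (Fintype.card W : ENNReal)⁻¹

end Semantics

end WorkStealing

set_option linter.unusedSimpArgs false
set_option linter.unusedSectionVars false

namespace WorkStealing

/-! ### Counting executions and submissions in task-level scheduling. -/

section TaskLevelLemmas

variable {T D : Type*} [Fintype T] [DecidableEq T] {g : HTDG T D}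

/-! Safety is a simulation. `State.toTaskState` collects the tasks wherever they lie; running a
callable is an `execute` step, decrementing a counter is a `release` step, and every other action
only moves a task from one summand of `ready` to another (`WorkerStep.follows`). What must be
excluded is that a worker overwrites a task it holds, which is part of the invariant `State.Local`.

Liveness is by contradiction. Let a task of domain `d` be ready and suppose that no task of `d` is
executed from then on (`Starved`). A worker that holds a task reaches `invoke` by fairness, so no
worker of `d` ever holds one, and a nonempty queue for `d` stays nonempty. By
`GoodRun.worker_progress`, each worker of `d` either makes infinitely many steal attempts or finally
sleeps unnotified in `commit_wait`. In the first case it would sooner or later choose the nonempty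
queue as its victim and obtain a task; hence all workers of `d` sleep (`GoodRun.eventually_commit`).

This is refuted by the absence of lost wake-ups, the last two fields of `State.Inv`: while a queue
for `d` is nonempty, either the thread that pushed still has to treat the notification of `d`, or
some worker of `d` is not yet committed to sleeping without looking at that queue again. The
invariant survives because a worker that is not the last thief goes to sleep only while another
thief is awake, the last thief rescans all local queues first, and `submit_task` omits its
notification only after seeing an active worker or a thief. With everybody asleep the notification
would stay pending forever, against fairness. A queue of a worker for its own domain is simpler: it
is nonempty only while the owner is inside its exploit loop. Of the notifications, only those of
`submit_task` and of the submitter are needed.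

Randomness enters once: by the second Borel–Cantelli lemma, almost surely each worker chooses each
admissible victim infinitely often. This event does not mention the run, so the interleaving may
depend on the victims.

The statements on finite control flow are counting arguments about task-level scheduling:
`Follows.bounded_of_bounded_cond` bounds submissions by executions of predecessors, `TaskState.Once`
treats graphs without condition tasks, and `GoodRun.eventually_complete` combines boundedness with
liveness. -/

theorem TaskStep.executed_le {σ σ' : TaskState T} (h : TaskStep g σ σ') (t : T) :
    σ.executed t ≤ σ'.executed t := by
  cases h with
  | execute u r hu =>
    by_cases htu : t = u
    · subst htu; simp
    · simp [htu]
  | release x hx => exact le_rfl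

/-- Executions together with outstanding submissions never decrease. -/
theorem TaskStep.executed_add_count_le {σ σ' : TaskState T} (h : TaskStep g σ σ') (t : T) :
    σ.executed t + σ.ready.count t ≤ σ'.executed t + σ'.ready.count t := by
  cases h with
  | execute u r hu =>
    have hc : 0 < σ.ready.count u := Multiset.count_pos.2 hu
    by_cases htu : t = u
    · subst htu
      simp only [Function.update_self, Multiset.count_add, Multiset.count_erase_self]
      omega
    · simp only [Function.update_of_ne htu, Multiset.count_add, Multiset.count_erase_of_ne htu]
      omega
  | release x hx =>
    simp only [Multiset.count_add]
    omega

/-- An upper bound for the number of submissions of `t`. -/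
def submissionBound (g : HTDG T D) (e : T → ℕ) (t : T) : ℕ :=
  1 + ∑ p, e p * (if g.isCond p then 1 else (g.succ p).count t)

theorem submissionBound_update (e : T → ℕ) (u t : T) :
    submissionBound g (Function.update e u (e u + 1)) t =
      submissionBound g e t + (if g.isCond u then 1 else (g.succ u).count t) := by
  unfold submissionBound
  rw [← Finset.add_sum_erase _ _ (Finset.mem_univ u),
    ← Finset.add_sum_erase (a := u) _ (fun p => e p * _) (Finset.mem_univ u)]
  have : ∀ p ∈ Finset.univ.erase u, Function.update e u (e u + 1) p *
      (if g.isCond p then 1 else (g.succ p).count t) =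
      e p * (if g.isCond p then 1 else (g.succ p).count t) := by
    intro p hp
    rw [Function.update_of_ne (Finset.ne_of_mem_erase hp)]
  rw [Finset.sum_congr rfl this, Function.update_self]
  ring

omit [Fintype T] in
theorem count_chosen_le (t u : T) (r : ℕ) :
    ((g.chosen u r).elim 0 (fun y => {y}) : Multiset T).count t ≤
      if g.isCond u then 1 else 0 := by
  unfold HTDG.chosen
  split
  · cases (g.succ u)[r]? with
    | none => simp
    | some y => simpa using Multiset.count_singleton t y ▸ (by split <;> simp)
  · simp

/-- Running `u` turns one ready copy of `u` into an execution, and what it adds to `ready` and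
`releasing` is covered by the growth of the bound. A release exchanges one copy in `releasing` for
at most one in `ready`. -/
theorem TaskStep.count_le_submissionBound {σ σ' : TaskState T} (h : TaskStep g σ σ') (t : T)
    (hσ : σ.executed t + σ.ready.count t + σ.releasing.count t ≤
      submissionBound g σ.executed t) :
    σ'.executed t + σ'.ready.count t + σ'.releasing.count t ≤
      submissionBound g σ'.executed t := by
  cases h with
  | execute u r hu =>
    have hc : 0 < σ.ready.count u := Multiset.count_pos.2 hu
    have h1 := count_chosen_le (g := g) t u r
    have h2 : (if g.isCond u then 0 else (g.succ u : Multiset T) : Multiset T).count t =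
        if g.isCond u then 0 else (g.succ u).count t := by
      split <;> simp
    simp only [submissionBound_update, Multiset.count_add, h2]
    have h3 : Function.update σ.executed u (σ.executed u + 1) t + (σ.ready.erase u).count t =
        σ.executed t + σ.ready.count t := by
      by_cases htu : t = u
      · subst htu
        simp only [Function.update_self, Multiset.count_erase_self]
        omega
      · simp only [Function.update_of_ne htu, Multiset.count_erase_of_ne htu]
    split at h1 <;> simp_all <;> omega
  | release x hx =>
    have hc : 0 < σ.releasing.count x := Multiset.count_pos.2 hx
    simp only [Multiset.count_add]
    by_cases htx : t = x
    · subst htx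
      rw [Multiset.count_erase_self]
      have : (if σ.counter t - 1 = 0 then {t} else 0 : Multiset T).count t ≤ 1 := by
        split <;> simp
      omega
    · have : (if σ.counter x - 1 = 0 then {x} else 0 : Multiset T).count t = 0 := by
        split <;> simp [htx]
      rw [Multiset.count_erase_of_ne htx]
      omega

/-- `σ` is a (stuttering) task-level scheduling of `g`. -/
structure Follows (g : HTDG T D) (σ : ℕ → TaskState T) : Prop where
  init : σ 0 = TaskState.init g
  step : ∀ n, σ (n + 1) = σ n ∨ TaskStep g (σ n) (σ (n + 1))

namespace Follows

variable {σ : ℕ → TaskState T}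

theorem executed_mono (hσ : Follows g σ) (t : T) : Monotone fun n => (σ n).executed t := by
  refine monotone_nat_of_le_succ fun n => ?_
  rcases hσ.step n with h | h
  · simp only [h, le_refl]
  · exact h.executed_le t

theorem executed_add_count_mono (hσ : Follows g σ) (t : T) :
    Monotone fun n => (σ n).executed t + (σ n).ready.count t := by
  refine monotone_nat_of_le_succ fun n => ?_
  rcases hσ.step n with h | h
  · simp only [h, le_refl]
  · exact h.executed_add_count_le t

theorem count_le_submissionBound (hσ : Follows g σ) (n : ℕ) (t : T) :
    (σ n).executed t + (σ n).ready.count t + (σ n).releasing.count t ≤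
      submissionBound g (σ n).executed t := by
  induction n with
  | zero =>
    have : g.sources.val.count t ≤ 1 := Multiset.nodup_iff_count_le_one.1 g.sources.nodup t
    rw [hσ.init]
    simp only [TaskState.init, submissionBound, Multiset.count_zero]
    omega
  | succ n ih =>
    rcases hσ.step n with h | h
    · rwa [h]
    · exact h.count_le_submissionBound t ih

/-- Well-founded induction along strong edges, available because the graph is finite and has no
strong cycle. In `submissionBound`, condition tasks contribute at most `B` each, strong predecessors
are bounded by induction, and all other tasks contribute nothing. -/
theorem bounded_of_bounded_cond (hσ : Follows g σ) (hg : g.StronglyAcyclic)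
    (hB : ∃ B, ∀ n t, g.isCond t = true → (σ n).executed t ≤ B) :
    ∃ B, ∀ n t, (σ n).executed t ≤ B := by
  obtain ⟨B, hB⟩ := hB
  have hwf : WellFounded (Relation.TransGen g.StrongEdge) := by
    have : Std.Irrefl (Relation.TransGen g.StrongEdge) := ⟨hg⟩
    exact Finite.wellFounded_of_trans_of_irrefl _
  have key : ∀ t, ∃ b, ∀ n, (σ n).executed t ≤ b := by
    intro t
    induction t using hwf.induction with
    | _ t ih =>
      have : ∀ p, ∃ b, ∀ n, (σ n).executed p *
          (if g.isCond p then 1 else (g.succ p).count t) ≤ b := by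
        intro p
        by_cases hp : g.isCond p = true
        · exact ⟨B, fun n => by simpa [hp] using hB n p hp⟩
        · by_cases ht : t ∈ g.succ p
          · obtain ⟨b, hb⟩ := ih p (.single ⟨by simpa using hp, ht⟩)
            exact ⟨b * (g.succ p).count t, fun n => by
              simpa [hp] using Nat.mul_le_mul_right _ (hb n)⟩
          · exact ⟨0, fun n => by simp [hp, List.count_eq_zero_of_not_mem ht]⟩
      choose b hb using this
      refine ⟨1 + ∑ p, b p, fun n => ?_⟩
      have h1 := hσ.count_le_submissionBound n t
      have h2 : submissionBound g (σ n).executed t ≤ 1 + ∑ p, b p :=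
        Nat.add_le_add_left (Finset.sum_le_sum fun p _ => hb p n) 1
      omega
  choose b hb using key
  exact ⟨∑ t, b t, fun n t => (hb t n).trans (Finset.single_le_sum (fun _ _ => Nat.zero_le _)
    (Finset.mem_univ t))⟩

end Follows

/-- The invariant of scheduling a graph without condition tasks: every task is submitted at most
once, exactly when `r t`, the number of dependencies removed so far, reaches its maximum. -/
structure TaskState.Once (g : HTDG T D) (σ : TaskState T) (r : T → ℕ) : Prop where
  le_one : ∀ t, σ.executed t + σ.ready.count t ≤ 1
  released : ∀ t, σ.releasing.count t + r t = ∑ p, σ.executed p * (g.succ p).count t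
  -- Restricted to tasks not yet run, since execution re-arms the counter.
  counter : ∀ t, σ.executed t = 0 → σ.counter t = g.numStrong t - r t
  submitted : ∀ t, σ.executed t + σ.ready.count t = 1 ↔ r t = g.numStrong t

theorem numStrong_eq (hc : ∀ t, g.isCond t = false) (t : T) :
    g.numStrong t = ∑ p, (g.succ p).count t := by
  simp [HTDG.numStrong, hc]

theorem TaskState.once_init (hc : ∀ t, g.isCond t = false) :
    (TaskState.init g).Once g fun _ => 0 where
  le_one t := by
    simpa [TaskState.init] using Multiset.nodup_iff_count_le_one.1 g.sources.nodup t
  released t := by simp [TaskState.init]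
  counter t _ := by simp [TaskState.init]
  submitted t := by
    simp only [TaskState.init, zero_add, numStrong_eq hc]
    rw [Multiset.count_eq_of_nodup g.sources.nodup, eq_comm (a := 0), Finset.sum_eq_zero_iff]
    simp [HTDG.sources, List.count_eq_zero]

/-- An execution keeps `r`. A release of `x` raises `r x` by one; as `x` has not been submitted
before, its counter has not been re-armed and hits zero exactly when `r x` reaches `numStrong x`. -/
theorem TaskStep.once (hc : ∀ t, g.isCond t = false) {σ σ' : TaskState T} {r : T → ℕ}
    (h : TaskStep g σ σ') (hσ : σ.Once g r) : ∃ r', σ'.Once g r' := by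
  cases h with
  | execute u i hu =>
    have hcu : 0 < σ.ready.count u := Multiset.count_pos.2 hu
    have h0 : g.chosen u i = none := by simp [HTDG.chosen, hc]
    have hsum : ∀ t, Function.update σ.executed u (σ.executed u + 1) t +
        (σ.ready.erase u).count t = σ.executed t + σ.ready.count t := by
      intro t
      by_cases htu : t = u
      · subst htu
        simp only [Function.update_self, Multiset.count_erase_self]
        omega
      · simp only [Function.update_of_ne htu, Multiset.count_erase_of_ne htu]
    refine ⟨r, ?_, ?_, ?_, ?_⟩
    · intro t
      simpa [h0, hsum] using hσ.le_one t
    · intro t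
      have h1 := submissionBound_update (g := g) σ.executed u t
      have h2 := hσ.released t
      simp only [submissionBound, hc, Bool.false_eq_true, if_false] at h1
      simp only [hc, Bool.false_eq_true, if_false, Multiset.count_add, Multiset.coe_count]
      omega
    · intro t ht
      by_cases htu : t = u
      · subst htu; simp at ht
      · simp only [Function.update_of_ne htu] at ht ⊢
        exact hσ.counter t ht
    · intro t
      simpa [h0, hsum] using hσ.submitted t
  | release x hx =>
    have hcx : 0 < σ.releasing.count x := Multiset.count_pos.2 hx
    -- All tasks have run at most once, so at most `numStrong x` dependencies of `x` were ever set
    -- free, and one of them is still in `releasing`.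
    have hlt : r x < g.numStrong x := by
      have h1 : ∑ p, σ.executed p * (g.succ p).count x ≤ g.numStrong x := by
        rw [numStrong_eq hc]
        refine Finset.sum_le_sum fun p _ => ?_
        have := hσ.le_one p
        exact (Nat.mul_le_mul_right _ (by omega)).trans (one_mul _).le
      have := hσ.released x
      omega
    have hx0 : σ.executed x + σ.ready.count x = 0 := by
      have h1 := hσ.le_one x
      have h2 := hσ.submitted x
      omega
    have hcnt := hσ.counter x (by omega)
    refine ⟨Function.update r x (r x + 1), ?_, ?_, ?_, ?_⟩
    · intro t
      by_cases htx : t = x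
      · subst htx
        simp only [Multiset.count_add]
        split <;> simp <;> omega
      · have := hσ.le_one t
        simp only [Multiset.count_add]
        split <;> simpa [htx] using this
    · intro t
      have := hσ.released t
      by_cases htx : t = x
      · subst htx
        simp only [Function.update_self, Multiset.count_erase_self]
        omega
      · simpa [htx, Multiset.count_erase_of_ne htx] using this
    · intro t ht
      by_cases htx : t = x
      · subst htx
        simp only [Function.update_self]
        push_cast
        omega
      · simpa [htx] using hσ.counter t ht
    · intro t
      by_cases htx : t = x
      · subst htx
        simp only [Function.update_self, Multiset.count_add]
        split <;> simp <;> omega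
      · have := hσ.submitted t
        simp only [Multiset.count_add]
        split <;> simpa [htx] using this

theorem Follows.exists_once (hc : ∀ t, g.isCond t = false) {σ : ℕ → TaskState T}
    (hσ : Follows g σ) (n : ℕ) : ∃ r, (σ n).Once g r := by
  induction n with
  | zero => exact ⟨_, hσ.init ▸ TaskState.once_init hc⟩
  | succ n ih =>
    obtain ⟨r, hr⟩ := ih
    rcases hσ.step n with h | h
    · exact ⟨r, h ▸ hr⟩
    · exact h.once hc hr

/-- If `t` has run, then all its dependencies were removed; an unexecuted predecessor would leave
the supply of removable dependencies short. Acyclicity plays no role here. -/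
theorem TaskState.Once.executed_le (hc : ∀ t, g.isCond t = false) {σ : TaskState T} {r : T → ℕ}
    (hσ : σ.Once g r) {p t : T} (hpt : t ∈ g.succ p) : σ.executed t ≤ σ.executed p := by
  by_contra! hlt
  have h1 := hσ.le_one t
  have h2 := (hσ.submitted t).1 (by omega)
  have h3 := hσ.released t
  have h4 : ∑ q, σ.executed q * (g.succ q).count t < g.numStrong t := by
    rw [numStrong_eq hc]
    refine Finset.sum_lt_sum (fun q _ => ?_) ⟨p, Finset.mem_univ p, ?_⟩
    · have := hσ.le_one q
      exact (Nat.mul_le_mul_right _ (by omega)).trans (one_mul _).le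
    · have : σ.executed p = 0 := by omega
      simpa [this] using List.count_pos_iff.2 hpt
  omega

/-- Well-founded induction: once all predecessors have run and nothing is being released, every
dependency of `t` has been removed, so `t` was submitted, and with `ready` empty it has run. -/
theorem TaskState.Once.executed_eq_one (hc : ∀ t, g.isCond t = false) (hg : g.StronglyAcyclic)
    {σ : TaskState T} {r : T → ℕ} (hσ : σ.Once g r) (hσc : σ.Complete) (t : T) :
    σ.executed t = 1 := by
  have hwf : WellFounded (Relation.TransGen g.StrongEdge) := by
    have : Std.Irrefl (Relation.TransGen g.StrongEdge) := ⟨hg⟩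
    exact Finite.wellFounded_of_trans_of_irrefl _
  induction t using hwf.induction with
  | _ t ih =>
    have h1 : ∑ q, σ.executed q * (g.succ q).count t = g.numStrong t := by
      rw [numStrong_eq hc]
      refine Finset.sum_congr rfl fun p _ => ?_
      by_cases hp : t ∈ g.succ p
      · rw [ih p (.single ⟨hc p, hp⟩), one_mul]
      · simp [List.count_eq_zero_of_not_mem hp]
    have h2 := hσ.released t
    simp only [hσc.2, Multiset.count_zero, zero_add] at h2
    have h3 := (hσ.submitted t).2 (h2.trans h1)
    simpa [hσc.1] using h3

end TaskLevelLemmas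

/-! ### Classes of control locations. -/

section Locations

variable {W D T : Type*}

/-- The locations at which the worker holds a task. -/
def PC.holds : PC W D T → Bool
  | .exploitReadThieves | .exploitNotify | .invoke | .leave | .leaveNotify => true
  | _ => false

/-- The locations at which the worker may or may not hold a task. -/
def PC.mayHold : PC W D T → Bool
  | .exploit | .explore _ => true
  | _ => false

/-- The locations inside the loop of `exploit_task`. -/
def PC.busy : PC W D T → Bool
  | .invoke | .release _ | .push _ _ | .submitReadActives _ _ | .submitReadThieves _ _
  | .submitNotify _ _ | .pop => true
  | _ => false

/-- The locations at which the worker contributes to `actives`. -/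
def PC.active : PC W D T → Bool
  | .exploitReadThieves | .exploitNotify | .invoke | .release _ | .push _ _
  | .submitReadActives _ _ | .submitReadThieves _ _ | .submitNotify _ _ | .pop | .decActives => true
  | _ => false

/-- The locations at which the worker contributes to `thieves`. -/
def PC.thief : PC W D T → Bool
  | .explore _ | .leave | .prepare | .checkShared | .cancelShared | .stealShared | .checkStop
  | .stopCancel | .stopNotify _ | .stopDec | .lastThief => true
  | _ => false

/-- The locations between `prepare_wait` and the end of the waiting. -/
def PC.waits : PC W D T → Bool
  | .checkShared | .cancelShared | .checkStop | .lastThief | .checkActives | .scan _ | .cancelRetry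
  | .commit => true
  | _ => false

/-- The locations that are reached only after the stop signal. -/
def PC.stopping : PC W D T → Bool
  | .stopCancel | .stopNotify _ | .stopDec | .exited => true
  | _ => false

/-- The locations from which the worker falls asleep without looking at the shared queue again. -/
def PC.pastShared : PC W D T → Prop
  | .checkStop | .lastThief | .checkActives | .scan _ | .commit => True
  | _ => False

/-- The locations from which the worker falls asleep without looking at the local queues of `x`
again. -/
def PC.pastWorker (x : W) : PC W D T → Prop
  | .commit => True
  | .scan l => x ∉ l
  | _ => False

/-- The locations of `submit_task` at which domain `d` may still have to be notified. -/
def PC.pending (d : D) : PC W D T → Prop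
  | .submitReadActives d' _ | .submitReadThieves d' _ | .submitNotify d' _ => d' = d
  | _ => False

end Locations

/-! ### What a single step can and cannot change. -/

section Frame

variable {W D T : Type*} [DecidableEq W]

/-- A normal form for both outcomes of a notification. The last clause is what rules out lost
wake-ups: afterwards some worker of the domain is not waiting, either the one just woken or, if none
was waiting, any. -/
theorem NotifyOne.eq_or {S : System W D T} {d : D} {s s' : State W D T} (h : NotifyOne S d s s') :
    ∃ f : W → Wait, s' = { s with wait := f } ∧
      (∀ w, f w = s.wait w ∨ s.wait w = .waiting ∧ f w = .notified) ∧
      ((∃ w, S.workerDomain w = d) → ∃ w, S.workerDomain w = d ∧ f w ≠ .waiting) := by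
  cases h with
  | wake w hd hw =>
    refine ⟨_, rfl, fun w' => ?_, fun _ => ⟨w, hd, by simp⟩⟩
    by_cases h : w' = w
    · subst h; right; simp [hw]
    · left; simp [h]
  | nobody h => exact ⟨s.wait, rfl, fun w => .inl rfl, fun ⟨w, hw⟩ => ⟨w, hw, h w hw⟩⟩

theorem NotifyOne.exists (S : System W D T) (d : D) (s : State W D T) :
    ∃ s', NotifyOne S d s s' := by
  by_cases h : ∃ w, S.workerDomain w = d ∧ s.wait w = .waiting
  · obtain ⟨w, hd, hw⟩ := h
    exact ⟨_, .wake w hd hw⟩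
  · exact ⟨s, .nobody fun w hd hw => h ⟨w, hd, hw⟩⟩

variable [DecidableEq D] [Fintype W] [Fintype D] [Fintype T] [DecidableEq T]
  {S : System W D T} {v : W → ℕ → Option W} {w : W} {s s' : State W D T}

attribute [local simp] State.goto State.setTask State.setWait State.setQueue State.setShared
  State.addActives State.addThieves State.notifyAll

namespace WorkerStep

theorem pc_of_ne (h : WorkerStep S v w s s') {x : W} (hx : x ≠ w) : s'.pc x = s.pc x := by
  cases h <;> try (rename_i hn; obtain ⟨f, rfl, hf⟩ := NotifyOne.eq_or hn)
  all_goals simp [hx]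

theorem task_of_ne (h : WorkerStep S v w s s') {x : W} (hx : x ≠ w) : s'.task x = s.task x := by
  cases h <;> try (rename_i hn; obtain ⟨f, rfl, hf⟩ := NotifyOne.eq_or hn)
  all_goals simp [hx]

theorem attempts_of_ne (h : WorkerStep S v w s s') {x : W} (hx : x ≠ w) :
    s'.attempts x = s.attempts x := by
  cases h <;> try (rename_i hn; obtain ⟨f, rfl, hf⟩ := NotifyOne.eq_or hn)
  all_goals simp [hx]

theorem wait_of_ne (h : WorkerStep S v w s s') {x : W} (hx : x ≠ w) :
    s'.wait x = s.wait x ∨ s.wait x = .waiting ∧ s'.wait x = .notified := by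
  cases h <;> try (rename_i hn; obtain ⟨f, rfl, hf, -⟩ := NotifyOne.eq_or hn; simpa using hf x)
  case stopNotify => simp; cases s.wait x <;> simp; tauto
  all_goals simp [hx]

theorem toSubmit_eq (h : WorkerStep S v w s s') : s'.toSubmit = s.toSubmit := by
  cases h <;> try (rename_i hn; obtain ⟨f, rfl, hf⟩ := NotifyOne.eq_or hn)
  all_goals simp

theorem toNotify_eq (h : WorkerStep S v w s s') : s'.toNotify = s.toNotify := by
  cases h <;> try (rename_i hn; obtain ⟨f, rfl, hf⟩ := NotifyOne.eq_or hn)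
  all_goals simp

theorem mem_shared (h : WorkerStep S v w s s') {d : D} {t : T} (ht : t ∈ s'.shared d) :
    t ∈ s.shared d := by
  cases h <;> try (rename_i hn; obtain ⟨f, rfl, hf⟩ := NotifyOne.eq_or hn)
  case attemptShared =>
    by_cases hd : d = S.workerDomain w
    · subst hd; simp at ht; exact List.mem_of_mem_dropLast ht
    · simpa [hd] using ht
  case stealShared =>
    by_cases hd : d = S.workerDomain w
    · subst hd; simp at ht; exact List.mem_of_mem_dropLast ht
    · simpa [hd] using ht
  all_goals simpa using ht

/-- Only `push` enlarges a queue, and a push for a foreign domain leads to the tests that decide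
about a notification. -/
theorem mem_queue (h : WorkerStep S v w s s') {x : W} {d : D} {t : T} (ht : t ∈ s'.queue x d) :
    t ∈ s.queue x d ∨
      x = w ∧ S.graph.domain t = d ∧ (S.workerDomain w ≠ d → (s'.pc w).pending d) := by
  cases h <;> try (rename_i hn; obtain ⟨f, rfl, hf⟩ := NotifyOne.eq_or hn)
  case pop =>
    left
    by_cases hx : x = w
    · subst hx
      by_cases hd : d = S.workerDomain x
      · subst hd; simp at ht; exact List.mem_of_mem_tail ht
      · simpa [hd] using ht
    · simpa [hx] using ht
  case attemptWorker k y _ _ _ _ =>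
    left
    by_cases hx : x = y
    · subst hx
      by_cases hd : d = S.workerDomain w
      · subst hd; simp at ht; exact List.mem_of_mem_dropLast ht
      · simpa [hd] using ht
    · simpa [hx] using ht
  case push y l hpc =>
    by_cases hx : x = w
    · subst hx
      by_cases hd : d = S.graph.domain y
      · subst hd
        simp only [State.goto, State.setQueue, Function.update_self, List.mem_cons] at ht
        rcases ht with rfl | ht
        · right
          exact ⟨rfl, rfl, fun hne => by simp [hne, PC.pending]⟩
        · exact .inl ht
      · left; simpa [hd] using ht
    · left; simpa [hx] using ht
  all_goals left; simpa using ht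

end WorkerStep

end Frame

/-! ### The inductive invariant: counters, placement of tasks, and absence of lost wake-ups. -/

section Invariants

variable {W D T : Type*} [DecidableEq W] [DecidableEq D] [Fintype W] [Fintype D] [Fintype T]
  [DecidableEq T] {S : System W D T} {v : W → ℕ → Option W} {w : W} {s s' : State W D T}

attribute [local simp] State.goto State.setTask State.setWait State.setQueue State.setShared
  State.addActives State.addThieves State.notifyAll

/-- The invariant of a single worker. -/
structure State.Local (S : System W D T) (s : State W D T) (w : W) : Prop where
  task_ne : (s.pc w).holds = true → s.task w ≠ none
  task_eq : (s.pc w).holds = false → (s.pc w).mayHold = false → s.task w = none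
  busy : s.queue w (S.workerDomain w) ≠ [] → (s.pc w).busy = true
  wait_ne : (s.pc w).waits = true → s.wait w ≠ .idle
  not_stopping : (s.pc w).stopping = false

theorem WorkerStep.task_ne (h : WorkerStep S v w s s') (hi : s.Local S w) :
    (s'.pc w).holds = true → s'.task w ≠ none := by
  have h1 := hi.task_ne
  have h2 := hi.task_eq
  cases h <;> try (rename_i hn; obtain ⟨f, rfl, hf⟩ := NotifyOne.eq_or hn)
  case invoke =>
    simp only [State.goto, State.setTask, Function.update_self]
    split
    · split <;> simp [PC.holds]
    · simp [PC.holds]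
  all_goals first
    | (simp_all [PC.holds]; done)
    | (simp only [State.goto, State.setTask, State.setQueue, State.setShared, State.addActives,
        State.addThieves, Function.update_self]
       split <;> simp_all [PC.holds])

theorem WorkerStep.task_eq (h : WorkerStep S v w s s') (hi : s.Local S w) :
    (s'.pc w).holds = false → (s'.pc w).mayHold = false → s'.task w = none := by
  have h1 := hi.task_ne
  have h2 := hi.task_eq
  cases h <;> try (rename_i hn; obtain ⟨f, rfl, hf⟩ := NotifyOne.eq_or hn)
  all_goals first
    | (simp_all [PC.holds, PC.mayHold]; done)
    | (simp only [State.goto, State.setTask, State.setQueue, State.setShared, State.addActives,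
        State.addThieves, Function.update_self]
       split <;> simp_all [PC.holds, PC.mayHold])

theorem WorkerStep.not_stopping (h : WorkerStep S v w s s') (hs : s.stopSignal = false)
    (hi : s.Local S w) : (s'.pc w).stopping = false := by
  have h1 := hi.not_stopping
  cases h <;> try (rename_i hn; obtain ⟨f, rfl, hf⟩ := NotifyOne.eq_or hn)
  case invoke =>
    simp only [State.goto, State.setTask, Function.update_self]
    split
    · split <;> simp [PC.stopping]
    · simp [PC.stopping]
  all_goals first
    | (simp_all [PC.stopping]; done)
    | (simp only [State.goto, State.setTask, State.setQueue, State.setShared, State.addActives,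
        State.addThieves, Function.update_self]
       split <;> simp_all [PC.stopping])

theorem WorkerStep.wait_ne (h : WorkerStep S v w s s') (hi : s.Local S w) :
    (s'.pc w).waits = true → s'.wait w ≠ .idle := by
  have h1 := hi.wait_ne
  cases h <;> try (rename_i hn; obtain ⟨f, rfl, hf⟩ := NotifyOne.eq_or hn)
  case invoke =>
    simp only [State.goto, State.setTask, Function.update_self]
    split
    · split <;> simp [PC.waits]
    · simp [PC.waits]
  all_goals first
    | (simp_all [PC.waits]; done)
    | (simp only [State.goto, State.setTask, State.setQueue, State.setShared, State.addActives,
        State.addThieves, Function.update_self]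
       split <;> simp_all [PC.waits])

/-- Only the owner pushes into its queues, and it leaves the exploit loop only when its pop finds
the queue for its own domain empty. -/
theorem WorkerStep.queue_busy (h : WorkerStep S v w s s') (hi : s.Local S w) :
    s'.queue w (S.workerDomain w) ≠ [] → (s'.pc w).busy = true := by
  have h1 := hi.busy
  cases h <;> try (rename_i hn; obtain ⟨f, rfl, hf⟩ := NotifyOne.eq_or hn)
  case invoke =>
    simp only [State.goto, State.setTask, Function.update_self]
    split
    · split <;> simp [PC.busy]
    · simp [PC.busy]
  case attemptWorker k x hpc ht hk hv =>
    have : s.queue w (S.workerDomain w) = [] := by simpa [hpc, PC.busy] using h1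
    by_cases hx : w = x
    · subst hx; simp [this]
    · simp [hx, this]
  all_goals first
    | (simp_all [PC.busy]; done)
    | (simp only [State.goto, State.setTask, State.setQueue, State.setShared, State.addActives,
        State.addThieves, Function.update_self]
       split <;> simp_all [PC.busy])

theorem WorkerStep.local_self (h : WorkerStep S v w s s') (hs : s.stopSignal = false)
    (hi : s.Local S w) : s'.Local S w :=
  ⟨h.task_ne hi, h.task_eq hi, h.queue_busy hi, h.wait_ne hi, h.not_stopping hs hi⟩

theorem WorkerStep.local_of_ne (h : WorkerStep S v w s s') {x : W} (hx : x ≠ w)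
    (hi : s.Local S x) : s'.Local S x where
  task_ne := by rw [h.pc_of_ne hx, h.task_of_ne hx]; exact hi.task_ne
  task_eq := by rw [h.pc_of_ne hx, h.task_of_ne hx]; exact hi.task_eq
  busy hq := by
    rw [h.pc_of_ne hx]
    obtain ⟨t, ht⟩ := List.exists_mem_of_ne_nil _ hq
    rcases h.mem_queue ht with h' | h'
    · exact hi.busy (List.ne_nil_of_mem h')
    · exact absurd h'.1 hx
  wait_ne := by
    rw [h.pc_of_ne hx]
    intro hw
    rcases h.wait_of_ne hx with h' | h'
    · rw [h']; exact hi.wait_ne hw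
    · simp [h'.2]
  not_stopping := by rw [h.pc_of_ne hx]; exact hi.not_stopping

theorem WorkerStep.domain_task (h : WorkerStep S v w s s')
    (hq : ∀ x d, ∀ t ∈ s.queue x d, S.graph.domain t = d)
    (hs : ∀ d, ∀ t ∈ s.shared d, S.graph.domain t = d)
    (ht : ∀ t, s.task w = some t → S.graph.domain t = S.workerDomain w) (t : T)
    (ht' : s'.task w = some t) : S.graph.domain t = S.workerDomain w := by
  cases h <;> try (rename_i hn; obtain ⟨f, rfl, hf⟩ := NotifyOne.eq_or hn)
  case pop => exact hq w _ t (List.mem_of_mem_head? (by simpa using ht'))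
  case attemptShared => exact hs _ t (List.mem_of_mem_getLast? (by simpa using ht'))
  case attemptWorker k x _ _ _ _ => exact hq x _ t (List.mem_of_mem_getLast? (by simpa using ht'))
  case stealShared => exact hs _ t (List.mem_of_mem_getLast? (by simpa using ht'))
  case invoke => simp at ht'
  all_goals exact ht t (by simpa using ht')

/-- The change of the counter equals the change of the contribution of `w`. Putting the old
contribution on the left gives the form that `sum_ite_eq_of_update` consumes. -/
theorem WorkerStep.actives_eq (h : WorkerStep S v w s s') (d : D) :
    s'.actives d + (if S.workerDomain w = d ∧ (s.pc w).active = true then 1 else 0) =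
      s.actives d + (if S.workerDomain w = d ∧ (s'.pc w).active = true then 1 else 0) := by
  cases h <;> try (rename_i hn; obtain ⟨f, rfl, hf⟩ := NotifyOne.eq_or hn)
  case invoke hpc _ =>
    simp only [State.goto, State.setTask, Function.update_self, hpc, apply_ite PC.active]
    cases S.graph.chosen _ _ <;> simp [PC.active]
  case exploitInc =>
    by_cases hd : d = S.workerDomain w
    · subst hd
      simp only [State.goto, State.addActives, Function.update_self, apply_ite PC.active]
      simp_all [PC.active]
    · simp [hd, Ne.symm hd]
  case decActives =>
    by_cases hd : d = S.workerDomain w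
    · subst hd
      simp_all [PC.active]
    · simp [hd, Ne.symm hd]
  all_goals first
    | (simp_all [PC.active]; done)
    | (simp only [State.goto, State.setTask, State.setQueue, State.setShared, State.addActives,
        State.addThieves, Function.update_self, apply_ite PC.active]
       simp_all [PC.active])

theorem WorkerStep.thieves_eq (h : WorkerStep S v w s s') (d : D) :
    s'.thieves d + (if S.workerDomain w = d ∧ (s.pc w).thief = true then 1 else 0) =
      s.thieves d + (if S.workerDomain w = d ∧ (s'.pc w).thief = true then 1 else 0) := by
  cases h <;> try (rename_i hn; obtain ⟨f, rfl, hf⟩ := NotifyOne.eq_or hn)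
  case invoke hpc _ =>
    simp only [State.goto, State.setTask, Function.update_self, hpc, apply_ite PC.thief]
    cases S.graph.chosen _ _ <;> simp [PC.thief]
  case incThieves =>
    by_cases hd : d = S.workerDomain w
    · subst hd
      simp_all [PC.thief]
    · simp [hd, Ne.symm hd]
  case stopDec =>
    by_cases hd : d = S.workerDomain w
    · subst hd
      simp_all [PC.thief]
    · simp [hd, Ne.symm hd]
  case leave =>
    by_cases hd : d = S.workerDomain w
    · subst hd
      simp only [State.goto, State.addThieves, Function.update_self, apply_ite PC.thief]
      simp_all [PC.thief]
    · simp [hd, Ne.symm hd]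
  case lastThief =>
    by_cases hd : d = S.workerDomain w
    · subst hd
      simp only [State.goto, State.addThieves, Function.update_self, apply_ite PC.thief]
      simp_all [PC.thief]
    · simp [hd, Ne.symm hd]
  all_goals first
    | (simp_all [PC.thief]; done)
    | (simp only [State.goto, State.setTask, State.setQueue, State.setShared, State.addActives,
        State.addThieves, Function.update_self, apply_ite PC.thief]
       simp_all [PC.thief])

/-- The worker waits, and falls asleep without looking at the shared queue again. -/
def State.Asleep (s : State W D T) (a : W) : Prop :=
  s.wait a = .waiting ∧ (s.pc a).pastShared

/-- The worker waits, and falls asleep without looking at the local queues of `x` again. -/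
def State.AsleepFor (s : State W D T) (x a : W) : Prop :=
  s.wait a = .waiting ∧ (s.pc a).pastWorker x

theorem WorkerStep.not_asleep_of_ne (h : WorkerStep S v w s s') {a : W} (ha : a ≠ w)
    (hs : ¬ s.Asleep a) : ¬ s'.Asleep a := by
  unfold State.Asleep at *
  rw [h.pc_of_ne ha]
  rcases h.wait_of_ne ha with h' | h'
  · rwa [h']
  · simp [h'.2]

theorem WorkerStep.not_asleepFor_of_ne (h : WorkerStep S v w s s') {a x : W} (ha : a ≠ w)
    (hs : ¬ s.AsleepFor x a) : ¬ s'.AsleepFor x a := by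
  unfold State.AsleepFor at *
  rw [h.pc_of_ne ha]
  rcases h.wait_of_ne ha with h' | h'
  · rwa [h']
  · simp [h'.2]

/-- The locations past the shared queue are entered only from `checkShared`, which lets a worker
through only if it sees the queue empty. -/
theorem WorkerStep.not_asleep_self (h : WorkerStep S v w s s')
    (hq : s.shared (S.workerDomain w) ≠ []) (hs : ¬ s.Asleep w) : ¬ s'.Asleep w := by
  unfold State.Asleep at *
  cases h <;> try (rename_i hn; obtain ⟨f, rfl, hf⟩ := NotifyOne.eq_or hn)
  case invoke hpc _ =>
    simp only [State.goto, State.setTask, Function.update_self]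
    split
    · split <;> simp [PC.pastShared]
    · simp [PC.pastShared]
  all_goals first
    | (simp_all [PC.pastShared]; done)
    | (simp only [State.goto, State.setTask, State.setQueue, State.setShared, State.addActives,
        State.addThieves, Function.update_self]
       split <;> simp_all [PC.pastShared])

/-- There are two ways to fall asleep for `x`: the scan passes `x`, impossible while that queue is
nonempty; or `lastThief` goes straight to `commit`, which it does only if `thieves` is still nonzero
after the decrement. -/
theorem WorkerStep.not_asleepFor_self (h : WorkerStep S v w s s') {x : W}
    (hq : s.queue x (S.workerDomain w) ≠ []) (hs : ¬ s.AsleepFor x w) :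
    ¬ s'.AsleepFor x w ∨ s'.thieves (S.workerDomain w) ≠ 0 := by
  unfold State.AsleepFor at *
  cases h <;> try (rename_i hn; obtain ⟨f, rfl, hf⟩ := NotifyOne.eq_or hn)
  case invoke hpc _ =>
    left
    simp only [State.goto, State.setTask, Function.update_self]
    split
    · split <;> simp [PC.pastWorker]
    · simp [PC.pastWorker]
  case scanNext y l hpc hy =>
    left
    by_cases hxy : x = y
    · subst hxy; simp [hq, PC.pastWorker]
    · simp only [State.goto, Function.update_self]
      split <;> simp_all [PC.pastWorker]
  case lastThief =>
    simp only [State.goto, State.addThieves, Function.update_self, ← sub_eq_add_neg]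
    split <;> simp_all [PC.pastWorker]
  all_goals first
    | (simp_all [PC.pastWorker]; done)
    | (simp only [State.goto, State.setTask, State.setQueue, State.setShared, State.addActives,
        State.addThieves, Function.update_self]
       split <;> simp_all [PC.pastWorker])

/-- These are the exits from the tests of `submit_task`: an active worker was seen, a thief was
seen, or the notification was sent. -/
theorem WorkerStep.pending (h : WorkerStep S v w s s') {d : D} (hd : ∃ a, S.workerDomain a = d)
    (hp : (s.pc w).pending d) :
    (s'.pc w).pending d ∨ s.actives d ≠ 0 ∨ s.thieves d ≠ 0 ∨
      ∃ a, S.workerDomain a = d ∧ s'.wait a ≠ .waiting := by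
  cases h <;> try (rename_i hn; obtain ⟨f, rfl, hf⟩ := NotifyOne.eq_or hn)
  case submitNotify d' l hpc =>
    obtain rfl : d' = d := by simpa [hpc, PC.pending] using hp
    exact .inr (.inr (.inr (hf.2 hd)))
  all_goals first
    | (simp_all [PC.pending]; done)
    | (simp only [State.goto, State.setTask, State.setQueue, State.setShared, State.addActives,
        State.addThieves, Function.update_self]
       split <;> simp_all [PC.pending])

/-- The invariant of the scheduler while the stop signal is not raised. -/
structure State.Inv (S : System W D T) (s : State W D T) : Prop where
  worker : ∀ w, s.Local S w
  domain_queue : ∀ x d, ∀ t ∈ s.queue x d, S.graph.domain t = d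
  domain_shared : ∀ d, ∀ t ∈ s.shared d, S.graph.domain t = d
  domain_task : ∀ w t, s.task w = some t → S.graph.domain t = S.workerDomain w
  actives : ∀ d, s.actives d =
    ∑ w, if S.workerDomain w = d ∧ (s.pc w).active = true then 1 else 0
  thieves : ∀ d, s.thieves d =
    ∑ w, if S.workerDomain w = d ∧ (s.pc w).thief = true then 1 else 0
  shared : ∀ d, (∃ a, S.workerDomain a = d) → s.shared d ≠ [] →
    s.toNotify = some d ∨ ∃ a, S.workerDomain a = d ∧ ¬ s.Asleep a
  queue : ∀ x d, (∃ a, S.workerDomain a = d) → S.workerDomain x ≠ d → s.queue x d ≠ [] →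
    (s.pc x).pending d ∨ ∃ a, S.workerDomain a = d ∧ ¬ s.AsleepFor x a

theorem State.Initial.inv (h : s.Initial S) : s.Inv S where
  worker w := by constructor <;> simp [h.pc, h.task, h.queue, h.wait, PC.holds, PC.mayHold,
    PC.waits, PC.stopping]
  domain_queue := by simp [h.queue]
  domain_shared := by simp [h.shared]
  domain_task := by simp [h.task]
  actives := by simp [h.actives, h.pc, PC.active]
  thieves := by simp [h.thieves, h.pc, PC.thief]
  shared := by simp [h.shared]
  queue := by simp [h.queue]

theorem exists_active (hi : s.Inv S) {d : D} (h : s.actives d ≠ 0) :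
    ∃ a, S.workerDomain a = d ∧ (s.pc a).active = true := by
  rw [hi.actives] at h
  obtain ⟨a, -, ha⟩ := Finset.exists_ne_zero_of_sum_ne_zero h
  exact ⟨a, by simpa using ha⟩

theorem exists_thief {d : D} (h : s.thieves d = ∑ w, if S.workerDomain w = d ∧ (s.pc w).thief = true
    then 1 else 0) (h0 : s.thieves d ≠ 0) :
    ∃ a, S.workerDomain a = d ∧ (s.pc a).thief = true := by
  rw [h] at h0
  obtain ⟨a, -, ha⟩ := Finset.exists_ne_zero_of_sum_ne_zero h0
  exact ⟨a, by simpa using ha⟩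

theorem not_asleepFor_of_active {x a : W} (h : (s.pc a).active = true) : ¬ s.AsleepFor x a := by
  rintro ⟨-, h'⟩
  cases hp : s.pc a <;> simp_all [PC.active, PC.pastWorker]

theorem not_asleepFor_of_thief {x a : W} (h : (s.pc a).thief = true) : ¬ s.AsleepFor x a := by
  rintro ⟨-, h'⟩
  cases hp : s.pc a <;> simp_all [PC.thief, PC.pastWorker]

theorem sum_ite_eq_of_update {p q : W → Prop} [DecidablePred p] [DecidablePred q] {a b : ℤ}
    (hpq : ∀ x, x ≠ w → (p x ↔ q x)) (h : b + (if p w then 1 else 0) = a + (if q w then 1 else 0))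
    (ha : a = ∑ x, if p x then 1 else 0) : b = ∑ x, if q x then 1 else 0 := by
  rw [← Finset.add_sum_erase _ _ (Finset.mem_univ w)] at ha ⊢
  have : ∑ x ∈ Finset.univ.erase w, (if q x then (1 : ℤ) else 0) =
      ∑ x ∈ Finset.univ.erase w, if p x then 1 else 0 :=
    Finset.sum_congr rfl fun x hx => by simp [hpq x (Finset.ne_of_mem_erase hx)]
  linarith

theorem WorkerStep.inv (h : WorkerStep S v w s s') (hs : s.stopSignal = false) (hi : s.Inv S) :
    s'.Inv S := by
  -- Proved ahead of the other fields, because the last one has to find a thief in the new state.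
  have hth : ∀ d, s'.thieves d =
      ∑ w, if S.workerDomain w = d ∧ (s'.pc w).thief = true then 1 else 0 := fun d =>
    sum_ite_eq_of_update (w := w) (fun x hx => by rw [h.pc_of_ne hx]) (h.thieves_eq d)
      (hi.thieves d)
  refine ⟨fun x => ?_, fun x d t ht => ?_, fun d t ht => ?_, fun x t ht => ?_, fun d => ?_, hth,
    fun d hd hq => ?_, fun x d hd hx hq => ?_⟩
  · by_cases hx : x = w
    · subst hx; exact h.local_self hs (hi.worker x)
    · exact h.local_of_ne hx (hi.worker x)
  · rcases h.mem_queue ht with h' | h'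
    · exact hi.domain_queue x d t h'
    · exact h'.2.1
  · exact hi.domain_shared d t (h.mem_shared ht)
  · by_cases hx : x = w
    · subst hx
      exact h.domain_task hi.domain_queue hi.domain_shared (hi.domain_task x) t ht
    · exact hi.domain_task x t (h.task_of_ne hx ▸ ht)
  · exact sum_ite_eq_of_update (w := w) (fun x hx => by rw [h.pc_of_ne hx]) (h.actives_eq d)
      (hi.actives d)
  · obtain ⟨t, ht⟩ := List.exists_mem_of_ne_nil _ hq
    have hq0 := List.ne_nil_of_mem (h.mem_shared ht)
    rcases hi.shared d hd hq0 with h' | ⟨a, had, ha⟩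
    · exact .inl (h.toNotify_eq ▸ h')
    · refine .inr ⟨a, had, ?_⟩
      by_cases haw : a = w
      · subst haw; exact h.not_asleep_self (had ▸ hq0) ha
      · exact h.not_asleep_of_ne haw ha
  · obtain ⟨t, ht⟩ := List.exists_mem_of_ne_nil _ hq
    rcases h.mem_queue ht with h' | ⟨rfl, -, h'⟩
    swap
    · exact .inl (h' hx)
    have hq0 := List.ne_nil_of_mem h'
    rcases hi.queue x d hd hx hq0 with hp | ⟨a, had, ha⟩
    · by_cases hxw : x = w
      · subst hxw
        rcases h.pending hd hp with h1 | h1 | h1 | ⟨a, had, ha⟩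
        · exact .inl h1
        -- The counter was read in the old state; the worker found there differs from `x`, whose
        -- domain is not `d`, so the step of `x` does not put it to sleep.
        · obtain ⟨a, had, ha⟩ := exists_active hi h1
          refine .inr ⟨a, had, h.not_asleepFor_of_ne ?_ (not_asleepFor_of_active ha)⟩
          rintro rfl; exact hx had
        · obtain ⟨a, had, ha⟩ := exists_thief (hi.thieves d) h1
          refine .inr ⟨a, had, h.not_asleepFor_of_ne ?_ (not_asleepFor_of_thief ha)⟩
          rintro rfl; exact hx had
        · exact .inr ⟨a, had, fun h => ha h.1⟩
      · exact .inl (h.pc_of_ne hxw ▸ hp)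
    · by_cases haw : a = w
      · subst haw
        subst had
        rcases h.not_asleepFor_self hq0 ha with h1 | h1
        · exact .inr ⟨a, rfl, h1⟩
        -- The worker that goes to sleep hands over its role as witness to a remaining thief.
        · obtain ⟨b, hbd, hb⟩ := exists_thief (hth _) h1
          exact .inr ⟨b, hbd, not_asleepFor_of_thief hb⟩
      · exact .inr ⟨a, had, h.not_asleepFor_of_ne haw ha⟩

theorem SubmitStep.inv (h : SubmitStep S s s') (hi : s.Inv S) : s'.Inv S := by
  cases h with
  | push t l h hn =>
    refine ⟨fun w => ⟨(hi.worker w).1, (hi.worker w).2, (hi.worker w).3, (hi.worker w).4,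
      (hi.worker w).5⟩, hi.domain_queue, fun d u hu => ?_, hi.domain_task, hi.actives, hi.thieves,
      fun d hd hq => ?_, hi.queue⟩
    · by_cases hd : d = S.graph.domain t
      · subst hd
        simp only [State.setShared, Function.update_self, List.mem_cons] at hu
        rcases hu with rfl | hu
        · rfl
        · exact hi.domain_shared _ u hu
      · exact hi.domain_shared d u (by simpa [hd] using hu)
    · by_cases hdt : d = S.graph.domain t
      · subst hdt; exact .inl rfl
      · rcases hi.shared d hd (by simpa [hdt] using hq) with h' | h'
        -- The submitter pushes only when it owes no notification, so no obligation for another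
        -- domain is overwritten.
        · simp [hn] at h'
        · exact .inr h'
  | notify d s₁ h hn =>
    obtain ⟨f, rfl, hf, hf'⟩ := NotifyOne.eq_or hn
    refine ⟨fun w => ⟨(hi.worker w).1, (hi.worker w).2, (hi.worker w).3, fun hw => ?_,
      (hi.worker w).5⟩, hi.domain_queue, hi.domain_shared, hi.domain_task, hi.actives, hi.thieves,
      fun d' hd hq => ?_, fun x d' hd hx hq => ?_⟩
    · rcases hf w with h' | h'
      · simpa [h'] using (hi.worker w).4 hw
      · simp [h'.2]
    · refine .inr ?_
      rcases hi.shared d' hd hq with h' | ⟨a, had, ha⟩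
      · obtain rfl : d = d' := by simpa [h] using h'
        obtain ⟨a, had, ha⟩ := hf' hd
        exact ⟨a, had, fun h => ha h.1⟩
      · refine ⟨a, had, fun h' => ha ⟨?_, h'.2⟩⟩
        have h1 : f a = .waiting := h'.1
        rcases hf a with h2 | h2
        · rw [← h2, h1]
        · exact h2.1
    · rcases hi.queue x d' hd hx hq with h' | ⟨a, had, ha⟩
      · exact .inl h'
      · refine .inr ⟨a, had, fun h' => ha ⟨?_, h'.2⟩⟩
        have h1 : f a = .waiting := h'.1
        rcases hf a with h2 | h2
        · rw [← h2, h1]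
        · exact h2.1

theorem EnvStep.eq (h : EnvStep s s') (hs : s'.stopSignal = false) : s' = s := by
  cases h with
  | skip => rfl
  | raiseStop => simp at hs

theorem IsRun.inv {s : ℕ → State W D T} {θ : ℕ → Option (Thread W)} (hr : IsRun S v s θ)
    (hnoStop : ∀ n, (s n).stopSignal = false) (n : ℕ) : (s n).Inv S := by
  induction n with
  | zero => exact hr.initial.inv
  | succ n ih =>
    cases hθ : θ n with
    | none => rw [(hr.env n hθ).eq (hnoStop _)]; exact ih
    | some i =>
      cases i with
      | worker w => exact WorkerStep.inv (hr.thread n _ hθ) (hnoStop n) ih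
      | submitter => exact SubmitStep.inv (hr.thread n _ hθ) ih

end Invariants

/-! ### The scheduler is simulated by task-level scheduling. -/

section Simulation

/-- Old and new values stand on opposite sides, so that no subtraction is needed in `M`, which will
be a type of multisets. -/
theorem sum_comp_update {ι α M : Type*} [Fintype ι] [DecidableEq ι] [AddCommMonoid M] (F : α → M)
    (f : ι → α) (i : ι) (a : α) :
    ∑ j, F (Function.update f i a j) + F (f i) = ∑ j, F (f j) + F a := by
  rw [← Finset.add_sum_erase _ _ (Finset.mem_univ i),
    ← Finset.add_sum_erase (a := i) _ (fun j => F (f j)) (Finset.mem_univ i),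
    Finset.sum_congr rfl fun j hj => by rw [Function.update_of_ne (Finset.ne_of_mem_erase hj)],
    Function.update_self]
  ac_rfl

theorem TaskState.ext_fields {T : Type*} {σ τ : TaskState T} (h1 : σ.ready = τ.ready)
    (h2 : σ.releasing = τ.releasing) (h3 : σ.counter = τ.counter)
    (h4 : σ.executed = τ.executed) : σ = τ := by
  cases σ; cases τ; simp_all

theorem coe_tail_add_head? {T : Type*} (l : List T) :
    (l.tail : Multiset T) + l.head?.elim 0 (fun t => {t}) = l := by
  cases l with
  | nil => simp
  | cons a l => simpa [add_comm] using Multiset.singleton_add a (l : Multiset T)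

theorem coe_dropLast_add_getLast? {T : Type*} (l : List T) :
    (l.dropLast : Multiset T) + l.getLast?.elim 0 (fun t => {t}) = l := by
  rcases List.eq_nil_or_concat l with rfl | ⟨l, a, rfl⟩
  · simp
  · simp [← Multiset.coe_add]

variable {W D T : Type*} [DecidableEq W] [DecidableEq D] [Fintype W] [Fintype D] [Fintype T]
  [DecidableEq T] {S : System W D T} {v : W → ℕ → Option W} {w : W} {s s' : State W D T}

theorem sum_update_queue (f : W → D → List T) (x : W) (d : D) (q : List T) :
    (∑ y, ∑ e, (Function.update f x (Function.update (f x) d q) y e : Multiset T)) + (f x d) =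
      (∑ y, ∑ e, (f y e : Multiset T)) + q := by
  have h1 := sum_comp_update (fun g : D → List T => ∑ e, (g e : Multiset T)) f x
    (Function.update (f x) d q)
  have h2 := sum_comp_update (fun l : List T => (l : Multiset T)) (f x) d q
  refine add_right_cancel (b := ∑ e, (f x e : Multiset T)) ?_
  rw [add_right_comm, h1, add_assoc, h2]
  ac_rfl

theorem toTaskState_congr (h1 : s'.toSubmit = s.toSubmit) (h2 : s'.shared = s.shared)
    (h3 : s'.queue = s.queue) (h4 : s'.task = s.task) (h5 : s'.counter = s.counter)
    (h6 : s'.executed = s.executed) (h7 : ∀ x, (s'.pc x).pushing = (s.pc x).pushing)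
    (h8 : ∀ x, (s'.pc x).releasing = (s.pc x).releasing) : s'.toTaskState = s.toTaskState := by
  simp only [State.toTaskState, h1, h2, h3, h4, h5, h6, h7, h8]

attribute [local simp] State.goto State.setTask State.setWait State.setQueue State.setShared
  State.addActives State.addThieves State.notifyAll

/-- `invoke` matches `execute` and `releaseNext` matches `release`; the rest stutters. Multiset
identities are checked multiplicity by multiplicity, which makes them linear arithmetic. The local
invariant is needed where `pop` and `stealShared` assign to `task`: its old value must be empty, or
a task would be lost. -/
theorem WorkerStep.follows (h : WorkerStep S v w s s') (hi : s.Local S w) :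
    s'.toTaskState = s.toTaskState ∨ TaskStep S.graph s.toTaskState s'.toTaskState := by
  cases h <;> try (rename_i hn; obtain ⟨f, rfl, hf⟩ := NotifyOne.eq_or hn)
  case invoke t r hpc ht =>
    right
    have e1 := sum_comp_update (fun o : Option T => (o.elim 0 fun t => {t} : Multiset T)) s.task w
      none
    generalize hc : (ite (S.graph.isCond t = true) _ _ : PC W D T) = c
    have e2 := sum_comp_update PC.pushing s.pc w c
    have e3 := sum_comp_update PC.releasing s.pc w c
    have hp : c.pushing = (S.graph.chosen t r).elim 0 (fun y => {y}) := by
      by_cases hcond : S.graph.isCond t = true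
      · cases hch : S.graph.chosen t r <;> simp [← hc, hcond, hch, PC.pushing]
      · simp [← hc, hcond, HTDG.chosen, PC.pushing]
    have hr : c.releasing = if S.graph.isCond t then 0 else (S.graph.succ t : Multiset T) := by
      by_cases hcond : S.graph.isCond t = true
      · cases hch : S.graph.chosen t r <;> simp [← hc, hcond, hch, PC.releasing]
      · simp [← hc, hcond, PC.releasing]
    rw [hp, show (s.pc w).pushing = 0 by rw [hpc]; rfl, add_zero] at e2
    rw [hr, show (s.pc w).releasing = 0 by rw [hpc]; rfl, add_zero] at e3
    simp only [ht, Option.elim_some, Option.elim_none, add_zero] at e1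
    have hmem : t ∈ s.toTaskState.ready := by
      have : t ∈ ∑ w, ((s.task w).elim 0 fun t => {t} : Multiset T) := by
        rw [← e1]; simp
      simp only [State.toTaskState, Multiset.mem_add]
      exact .inl (.inr this)
    refine Eq.subst (motive := TaskStep S.graph _) ?_ (TaskStep.execute s.toTaskState t r hmem)
    have he := Multiset.cons_erase hmem
    refine TaskState.ext_fields ?_ e3.symm rfl rfl
    refine Multiset.ext.2 fun u => ?_
    have a1 := congrArg (Multiset.count u) e1
    have a2 := congrArg (Multiset.count u) e2
    have a3 := congrArg (Multiset.count u) he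
    rw [← Multiset.singleton_add] at a3
    simp only [State.toTaskState, State.goto, State.setTask, Multiset.count_add] at a1 a2 a3 ⊢
    omega
  case releaseNext x l hpc =>
    right
    set c : PC W D T := if s.counter x - 1 = 0 then .push x l else .release l with hc
    have e2 := sum_comp_update PC.pushing s.pc w c
    have e3 := sum_comp_update PC.releasing s.pc w c
    have hp : c.pushing = if s.counter x - 1 = 0 then {x} else 0 := by
      simp only [hc, apply_ite PC.pushing]; rfl
    have hr : c.releasing = l := by
      simp only [hc, apply_ite PC.releasing]; simp [PC.releasing]
    rw [hp, show (s.pc w).pushing = 0 by rw [hpc]; rfl, add_zero] at e2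
    rw [hr, show (s.pc w).releasing = ↑(x :: l) by rw [hpc]; rfl] at e3
    have hmem : x ∈ s.toTaskState.releasing := by
      have : x ∈ ∑ w, (s.pc w).releasing + (l : Multiset T) := by
        rw [← e3]; simp
      have h2 := Finset.single_le_sum (f := fun w => (s.pc w).releasing)
        (fun _ _ => Multiset.zero_le _) (Finset.mem_univ w)
      simp only [hpc, PC.releasing] at h2
      exact Multiset.mem_of_le h2 (by simp)
    refine Eq.subst (motive := TaskStep S.graph _) ?_ (TaskStep.release s.toTaskState x hmem)
    have he := Multiset.cons_erase hmem
    refine TaskState.ext_fields ?_ ?_ rfl rfl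
    · simp only [State.toTaskState, State.goto, e2, add_assoc]
    · refine Multiset.ext.2 fun u => ?_
      have a2 := congrArg (Multiset.count u) e3
      have a3 := congrArg (Multiset.count u) he
      rw [← Multiset.singleton_add] at a3
      rw [← Multiset.cons_coe, ← Multiset.singleton_add] at a2
      simp only [State.toTaskState, State.goto, Multiset.count_add] at a2 a3 ⊢
      omega
  case push x l hpc =>
    left
    set c : PC W D T := if S.workerDomain w = S.graph.domain x then .release l
      else .submitReadActives (S.graph.domain x) l with hc
    have e1 := sum_update_queue s.queue w (S.graph.domain x)
      (x :: s.queue w (S.graph.domain x))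
    have e2 := sum_comp_update PC.pushing s.pc w c
    have e3 := sum_comp_update PC.releasing s.pc w c
    have hp : c.pushing = 0 := by
      simp only [hc, apply_ite PC.pushing]; simp [PC.pushing]
    have hr : c.releasing = l := by
      simp only [hc, apply_ite PC.releasing]; simp [PC.releasing]
    rw [hp, show (s.pc w).pushing = {x} by rw [hpc]; rfl, add_zero] at e2
    rw [hr, show (s.pc w).releasing = l by rw [hpc]; rfl] at e3
    refine TaskState.ext_fields ?_ (add_right_cancel e3) rfl rfl
    refine Multiset.ext.2 fun u => ?_
    have a1 := congrArg (Multiset.count u) e1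
    have a2 := congrArg (Multiset.count u) e2
    rw [← Multiset.cons_coe, ← Multiset.singleton_add] at a1
    simp only [State.toTaskState, State.goto, State.setQueue, Multiset.count_add] at a1 a2 ⊢
    omega
  case pop hpc =>
    left
    have ht : s.task w = none := hi.task_eq (by rw [hpc]; rfl) (by rw [hpc]; rfl)
    set c : PC W D T := if s.queue w (S.workerDomain w) = [] then .decActives else .invoke with hc
    have e0 := sum_update_queue s.queue w (S.workerDomain w) (s.queue w (S.workerDomain w)).tail
    have e1 := sum_comp_update (fun o : Option T => (o.elim 0 fun t => {t} : Multiset T)) s.task w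
      (s.queue w (S.workerDomain w)).head?
    have e := coe_tail_add_head? (s.queue w (S.workerDomain w))
    have e2 := sum_comp_update PC.pushing s.pc w c
    have e3 := sum_comp_update PC.releasing s.pc w c
    have hp : c.pushing = 0 := by
      simp only [hc, apply_ite PC.pushing]; simp [PC.pushing]
    have hr : c.releasing = 0 := by
      simp only [hc, apply_ite PC.releasing]; simp [PC.releasing]
    rw [hp, show (s.pc w).pushing = 0 by rw [hpc]; rfl, add_zero, add_zero] at e2
    rw [hr, show (s.pc w).releasing = 0 by rw [hpc]; rfl, add_zero, add_zero] at e3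
    simp only [ht, Option.elim_none, add_zero] at e1
    refine TaskState.ext_fields ?_ e3 rfl rfl
    refine Multiset.ext.2 fun u => ?_
    have b0 := congrArg (Multiset.count u) e0
    have b1 := congrArg (Multiset.count u) e1
    have b2 := congrArg (Multiset.count u) e2
    have b := congrArg (Multiset.count u) e
    simp only [State.toTaskState, State.goto, State.setQueue, State.setTask,
      Multiset.count_add] at b0 b1 b2 b ⊢
    omega
  case attemptShared k hpc ht hk hv =>
    left
    have e0 := sum_comp_update (fun l : List T => (l : Multiset T)) s.shared (S.workerDomain w)
      (s.shared (S.workerDomain w)).dropLast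
    have e1 := sum_comp_update (fun o : Option T => (o.elim 0 fun t => {t} : Multiset T)) s.task w
      (s.shared (S.workerDomain w)).getLast?
    have e := coe_dropLast_add_getLast? (s.shared (S.workerDomain w))
    have e2 := sum_comp_update PC.pushing s.pc w (.explore (k + 1))
    have e3 := sum_comp_update PC.releasing s.pc w (.explore (k + 1))
    rw [show (PC.explore (k + 1) : PC W D T).pushing = 0 from rfl,
      show (s.pc w).pushing = 0 by rw [hpc]; rfl, add_zero, add_zero] at e2
    rw [show (PC.explore (k + 1) : PC W D T).releasing = 0 from rfl,
      show (s.pc w).releasing = 0 by rw [hpc]; rfl, add_zero, add_zero] at e3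
    simp only [ht, Option.elim_none, add_zero] at e1
    refine TaskState.ext_fields ?_ e3 rfl rfl
    refine Multiset.ext.2 fun u => ?_
    have b0 := congrArg (Multiset.count u) e0
    have b1 := congrArg (Multiset.count u) e1
    have b2 := congrArg (Multiset.count u) e2
    have b := congrArg (Multiset.count u) e
    simp only [State.toTaskState, State.goto, State.setShared, State.setTask,
      Multiset.count_add] at b0 b1 b2 b ⊢
    omega
  case attemptWorker k x hpc ht hk hv =>
    left
    have e0 := sum_update_queue s.queue x (S.workerDomain w)
      (s.queue x (S.workerDomain w)).dropLast
    have e1 := sum_comp_update (fun o : Option T => (o.elim 0 fun t => {t} : Multiset T)) s.task w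
      (s.queue x (S.workerDomain w)).getLast?
    have e := coe_dropLast_add_getLast? (s.queue x (S.workerDomain w))
    have e2 := sum_comp_update PC.pushing s.pc w (.explore (k + 1))
    have e3 := sum_comp_update PC.releasing s.pc w (.explore (k + 1))
    rw [show (PC.explore (k + 1) : PC W D T).pushing = 0 from rfl,
      show (s.pc w).pushing = 0 by rw [hpc]; rfl, add_zero, add_zero] at e2
    rw [show (PC.explore (k + 1) : PC W D T).releasing = 0 from rfl,
      show (s.pc w).releasing = 0 by rw [hpc]; rfl, add_zero, add_zero] at e3
    simp only [ht, Option.elim_none, add_zero] at e1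
    refine TaskState.ext_fields ?_ e3 rfl rfl
    refine Multiset.ext.2 fun u => ?_
    have b0 := congrArg (Multiset.count u) e0
    have b1 := congrArg (Multiset.count u) e1
    have b2 := congrArg (Multiset.count u) e2
    have b := congrArg (Multiset.count u) e
    simp only [State.toTaskState, State.goto, State.setQueue, State.setTask,
      Multiset.count_add] at b0 b1 b2 b ⊢
    omega
  case stealShared hpc =>
    left
    have ht : s.task w = none := hi.task_eq (by rw [hpc]; rfl) (by rw [hpc]; rfl)
    set c : PC W D T := if s.shared (S.workerDomain w) = [] then .explore 0 else .leave with hc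
    have e0 := sum_comp_update (fun l : List T => (l : Multiset T)) s.shared (S.workerDomain w)
      (s.shared (S.workerDomain w)).dropLast
    have e1 := sum_comp_update (fun o : Option T => (o.elim 0 fun t => {t} : Multiset T)) s.task w
      (s.shared (S.workerDomain w)).getLast?
    have e := coe_dropLast_add_getLast? (s.shared (S.workerDomain w))
    have e2 := sum_comp_update PC.pushing s.pc w c
    have e3 := sum_comp_update PC.releasing s.pc w c
    have hp : c.pushing = 0 := by
      simp only [hc, apply_ite PC.pushing]; simp [PC.pushing]
    have hr : c.releasing = 0 := by
      simp only [hc, apply_ite PC.releasing]; simp [PC.releasing]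
    rw [hp, show (s.pc w).pushing = 0 by rw [hpc]; rfl, add_zero, add_zero] at e2
    rw [hr, show (s.pc w).releasing = 0 by rw [hpc]; rfl, add_zero, add_zero] at e3
    simp only [ht, Option.elim_none, add_zero] at e1
    refine TaskState.ext_fields ?_ e3 rfl rfl
    refine Multiset.ext.2 fun u => ?_
    have b0 := congrArg (Multiset.count u) e0
    have b1 := congrArg (Multiset.count u) e1
    have b2 := congrArg (Multiset.count u) e2
    have b := congrArg (Multiset.count u) e
    simp only [State.toTaskState, State.goto, State.setShared, State.setTask,
      Multiset.count_add] at b0 b1 b2 b ⊢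
    omega
  all_goals
    left
    refine toTaskState_congr rfl rfl rfl rfl rfl rfl ?_ ?_
    all_goals
      intro x
      by_cases hx : x = w
      · subst hx
        simp only [State.goto, State.setTask, State.setWait, State.setQueue, State.setShared,
          State.addActives, State.addThieves, State.notifyAll, Function.update_self,
          apply_ite PC.pushing, apply_ite PC.releasing]
        simp_all [PC.pushing, PC.releasing]
      · simp [hx]

theorem SubmitStep.follows (h : SubmitStep S s s') : s'.toTaskState = s.toTaskState := by
  cases h with
  | push t l h hn =>
    have e0 := sum_comp_update (fun l : List T => (l : Multiset T)) s.shared (S.graph.domain t)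
      (t :: s.shared (S.graph.domain t))
    refine TaskState.ext_fields ?_ rfl rfl rfl
    refine Multiset.ext.2 fun u => ?_
    have b0 := congrArg (Multiset.count u) e0
    rw [← Multiset.cons_coe, ← Multiset.singleton_add] at b0
    simp only [State.toTaskState, State.setShared, h, Multiset.count_add] at b0 ⊢
    rw [← Multiset.cons_coe, ← Multiset.singleton_add, Multiset.count_add]
    omega
  | notify d s₁ h hn =>
    obtain ⟨f, rfl, -⟩ := NotifyOne.eq_or hn
    rfl

theorem State.Initial.toTaskState (h : s.Initial S) : s.toTaskState = TaskState.init S.graph := by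
  refine TaskState.ext_fields ?_ ?_ (funext h.counter) (funext h.executed)
  · simp [State.toTaskState, TaskState.init, h.toSubmit, h.shared, h.queue, h.task, h.pc,
      PC.pushing]
  · simp [State.toTaskState, TaskState.init, h.pc, PC.releasing]

theorem IsRun.follows {s : ℕ → State W D T} {θ : ℕ → Option (Thread W)} (hr : IsRun S v s θ)
    (hnoStop : ∀ n, (s n).stopSignal = false) : Follows S.graph fun n => (s n).toTaskState where
  init := hr.initial.toTaskState
  step n := by
    cases hθ : θ n with
    | none => exact .inl (by rw [(hr.env n hθ).eq (hnoStop _)])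
    | some i =>
      cases i with
      | worker w => exact WorkerStep.follows (hr.thread n _ hθ) ((hr.inv hnoStop n).worker w)
      | submitter => exact .inl (SubmitStep.follows (hr.thread n _ hθ))

end Simulation

/-! ### Liveness: progress of workers and impossibility of starvation. -/

section Liveness

open Filter

variable {W D T : Type*} [DecidableEq W] [DecidableEq D] [Fintype W] [Fintype D] [Fintype T]
  [DecidableEq T] {S : System W D T} {v : W → ℕ → Option W} {w : W} {s s' : State W D T}

/-- A bound for the number of steps that the worker makes until it is at `invoke`, or at a steal
attempt, or blocked. -/
def PC.rank (n m : ℕ) (o : Option T) : PC W D T → ℕ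
  | .exploit => if o.isSome then 8 else 13
  | .exploitReadThieves => 7
  | .exploitNotify => 6
  -- A successor costs at most five actions: the decrement, the push, two tests and the
  -- notification.
  | .release l => 16 + 5 * l.length
  | .push _ l => 20 + 5 * l.length
  | .submitReadActives _ l => 19 + 5 * l.length
  | .submitReadThieves _ l => 18 + 5 * l.length
  | .submitNotify _ l => 17 + 5 * l.length
  | .pop => 15
  | .decActives => 14
  | .incThieves => 12
  -- A genuine steal attempt has rank zero, as the number of failed attempts is unbounded. After the
  -- last one, `n` (the number of workers) leaves room for the scan.
  | .explore k => if o.isSome then 11 else if k < m then 0 else 21 + n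
  | .leave => 10
  | .leaveNotify => 9
  | .prepare => 20 + n
  | .checkShared => 19 + n
  | .cancelShared => 12
  | .stealShared => 11
  | .checkStop => 18 + n
  | .lastThief => 17 + n
  | .checkActives => 16 + n
  | .scan l => 15 + l.card
  | .cancelRetry => 13
  | .commit => 14
  | .invoke | .stopCancel | .stopNotify _ | .stopDec | .exited => 0

/-- The rank of worker `w`. -/
def State.rank (S : System W D T) (s : State W D T) (w : W) : ℕ :=
  (s.pc w).rank (Fintype.card W) S.maxSteal (s.task w)

attribute [local simp] State.goto State.setTask State.setWait State.setQueue State.setShared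
  State.addActives State.addThieves State.notifyAll

/-- Worker `w` is about to make a steal attempt. -/
def State.Stealing (S : System W D T) (s : State W D T) (w : W) : Prop :=
  ∃ k < S.maxSteal, s.pc w = .explore k ∧ s.task w = none

theorem invoke_or_stealing_of_rank (hi : s.Local S w) (h : s.rank S w = 0) :
    s.pc w = .invoke ∨ s.Stealing S w := by
  have h1 := hi.not_stopping
  unfold State.rank at h
  unfold State.Stealing
  cases hp : s.pc w <;> simp_all [PC.rank, PC.stopping]
  · split at h <;> simp at h
  · split_ifs at h <;> simp_all

namespace WorkerStep

/-- Every loop of the worker passes through `invoke` or a steal attempt. `1 ≤ S.maxSteal` ensures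
that entering `explore 0` without a task means facing an attempt, hence rank zero. -/
theorem rank_lt (h : WorkerStep S v w s s') (hs : s.stopSignal = false) (hm : 1 ≤ S.maxSteal)
    (hi : s.Local S w) (h0 : s.rank S w ≠ 0) : s'.rank S w < s.rank S w := by
  have h1 := hi.task_ne
  have h2 := hi.task_eq
  have h3 := hi.not_stopping
  have hm' : 0 < S.maxSteal := hm
  unfold State.rank at *
  cases h <;> try (rename_i hn; obtain ⟨f, rfl, hf⟩ := NotifyOne.eq_or hn)
  case exploreFail k hpc ht hk => simp [hpc, PC.rank, ht, not_lt.2 hk]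
  case scanNext x l hpc hx =>
    have := Finset.card_erase_lt_of_mem hx
    simp only [State.goto, Function.update_self, hpc]
    split <;> simp only [PC.rank] <;> omega
  case invoke hpc _ => simp [hpc, PC.rank] at h0
  case leaveNotify hpc =>
    obtain ⟨t, ht⟩ := Option.ne_none_iff_exists'.1 (h1 (by rw [hpc]; rfl))
    simp [hpc, PC.rank, ht]
  case leave hpc =>
    obtain ⟨t, ht⟩ := Option.ne_none_iff_exists'.1 (h1 (by rw [hpc]; rfl))
    simp only [State.goto, State.addThieves, Function.update_self, hpc]
    split <;> simp [PC.rank, ht]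
  case stealShared hpc =>
    simp only [State.goto, State.setTask, State.setShared, Function.update_self, hpc]
    split
    · rename_i hq
      simp [PC.rank, hq, hm']
    · simp [PC.rank]
  case incThieves hpc =>
    have ht := h2 (by rw [hpc]; rfl) (by rw [hpc]; rfl)
    simp [hpc, PC.rank, ht, hm']
  all_goals first
    | (simp_all [PC.rank, PC.holds, PC.mayHold]; done)
    | (simp_all [PC.rank, PC.holds, PC.mayHold]; omega)
    | (simp only [State.goto, State.setTask, State.setQueue, State.setShared, State.addActives,
        State.addThieves, Function.update_self]
       split <;> simp_all [PC.rank, PC.holds, PC.mayHold] <;> omega)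

/-- Only `commit_wait` blocks. The invariant supplies the task at `invoke` and excludes the
locations reached after a stop signal. -/
theorem exists_of_ne_commit (v : W → ℕ → Option W) (hi : s.Local S w) (hc : s.pc w ≠ .commit) :
    ∃ s', WorkerStep S v w s s' := by
  have h1 := hi.task_ne
  have h3 := hi.not_stopping
  cases hp : s.pc w with
  | exploit =>
    cases ht : s.task w with
    | none => exact ⟨_, .exploitNil hp ht⟩
    | some t => exact ⟨_, .exploitInc t hp ht⟩
  | exploitReadThieves => exact ⟨_, .exploitReadThieves hp⟩
  | exploitNotify =>
    obtain ⟨s₁, h⟩ := NotifyOne.exists S (S.workerDomain w) s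
    exact ⟨_, .exploitNotify s₁ hp h⟩
  | invoke =>
    obtain ⟨t, ht⟩ := Option.ne_none_iff_exists'.1 (h1 (by rw [hp]; rfl))
    exact ⟨_, .invoke t 0 hp ht⟩
  | release l =>
    cases l with
    | nil => exact ⟨_, .releaseDone hp⟩
    | cons x l => exact ⟨_, .releaseNext x l hp⟩
  | push x l => exact ⟨_, .push x l hp⟩
  | submitReadActives d l => exact ⟨_, .submitReadActives d l hp⟩
  | submitReadThieves d l => exact ⟨_, .submitReadThieves d l hp⟩
  | submitNotify d l =>
    obtain ⟨s₁, h⟩ := NotifyOne.exists S d s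
    exact ⟨_, .submitNotify d l s₁ hp h⟩
  | pop => exact ⟨_, .pop hp⟩
  | decActives => exact ⟨_, .decActives hp⟩
  | incThieves => exact ⟨_, .incThieves hp⟩
  | explore k =>
    cases ht : s.task w with
    | some t => exact ⟨_, .exploreSuccess k t hp ht⟩
    | none =>
      by_cases hk : k < S.maxSteal
      · cases hv : v w (s.attempts w) with
        | none => exact ⟨_, .attemptShared k hp ht hk hv⟩
        | some x => exact ⟨_, .attemptWorker k x hp ht hk hv⟩
      · exact ⟨_, .exploreFail k hp ht (not_lt.1 hk)⟩
  | leave => exact ⟨_, .leave hp⟩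
  | leaveNotify =>
    obtain ⟨s₁, h⟩ := NotifyOne.exists S (S.workerDomain w) s
    exact ⟨_, .leaveNotify s₁ hp h⟩
  | prepare => exact ⟨_, .prepare hp⟩
  | checkShared => exact ⟨_, .checkShared hp⟩
  | cancelShared => exact ⟨_, .cancelShared hp⟩
  | stealShared => exact ⟨_, .stealShared hp⟩
  | checkStop => exact ⟨_, .checkStop hp⟩
  | lastThief => exact ⟨_, .lastThief hp⟩
  | checkActives => exact ⟨_, .checkActives hp⟩
  | scan l =>
    rcases l.eq_empty_or_nonempty with rfl | ⟨x, hx⟩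
    · exact ⟨_, .scanDone hp⟩
    · exact ⟨_, .scanNext x l hp hx⟩
  | cancelRetry => exact ⟨_, .cancelRetry hp⟩
  | commit => exact absurd hp hc
  | stopCancel => simp [hp, PC.stopping] at h3
  | stopNotify l => simp [hp, PC.stopping] at h3
  | stopDec => simp [hp, PC.stopping] at h3
  | exited => simp [hp, PC.stopping] at h3

theorem task_stable (h : WorkerStep S v w s s') (hi : s.Local S w) (hp : s.pc w ≠ .invoke)
    (ht : s.task w ≠ none) : s'.task w ≠ none := by
  have h2 := hi.task_eq
  cases h <;> try (rename_i hn; obtain ⟨f, rfl, hf⟩ := NotifyOne.eq_or hn)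
  case pop hpc => exact absurd (h2 (by rw [hpc]; rfl) (by rw [hpc]; rfl)) ht
  case stealShared hpc => exact absurd (h2 (by rw [hpc]; rfl) (by rw [hpc]; rfl)) ht
  all_goals simp_all

theorem executed_of_invoke (h : WorkerStep S v w s s') (hp : s.pc w = .invoke) :
    ∃ t, s.task w = some t ∧ s'.executed t = s.executed t + 1 := by
  cases h <;> try (rename_i hn; obtain ⟨f, rfl, hf⟩ := NotifyOne.eq_or hn)
  case invoke t r hpc ht => exact ⟨t, ht, by simp⟩
  all_goals simp_all

theorem queue_ne_nil (h : WorkerStep S v w s s') {x : W} {d : D} (hq : s.queue x d ≠ []) :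
    s'.queue x d ≠ [] ∨ S.workerDomain w = d ∧ s'.task w ≠ none := by
  cases h <;> try (rename_i hn; obtain ⟨f, rfl, hf⟩ := NotifyOne.eq_or hn)
  case pop hpc =>
    by_cases hd : d = S.workerDomain w
    · subst hd
      by_cases hx : x = w
      · subst hx; right; simpa using hq
      · left; simpa [hx] using hq
    · left
      by_cases hx : x = w
      · subst hx; simpa [hd] using hq
      · simpa [hx] using hq
  case attemptWorker k y hpc ht hk hv =>
    by_cases hd : d = S.workerDomain w
    · subst hd
      by_cases hx : x = y
      · subst hx; right; simpa using hq
      · left; simpa [hx] using hq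
    · left
      by_cases hx : x = y
      · subst hx; simpa [hd] using hq
      · simpa [hx] using hq
  case push y l hpc =>
    left
    by_cases hx : x = w
    · subst hx
      by_cases hd : d = S.graph.domain y
      · subst hd; simp
      · simpa [hd] using hq
    · simpa [hx] using hq
  all_goals left; simpa using hq

theorem shared_ne_nil (h : WorkerStep S v w s s') {d : D} (hq : s.shared d ≠ []) :
    s'.shared d ≠ [] ∨ S.workerDomain w = d ∧ s'.task w ≠ none := by
  cases h <;> try (rename_i hn; obtain ⟨f, rfl, hf⟩ := NotifyOne.eq_or hn)
  case attemptShared =>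
    by_cases hd : d = S.workerDomain w
    · subst hd; right; simpa using hq
    · left; simpa [hd] using hq
  case stealShared =>
    by_cases hd : d = S.workerDomain w
    · subst hd; right; simpa using hq
    · left; simpa [hd] using hq
  all_goals left; simpa using hq

theorem attempts_eq_or (h : WorkerStep S v w s s') :
    s'.attempts w = s.attempts w ∨ s'.attempts w = s.attempts w + 1 ∧
      ((v w (s.attempts w) = none → s'.task w = (s.shared (S.workerDomain w)).getLast?) ∧
        ∀ x, v w (s.attempts w) = some x → s'.task w = (s.queue x (S.workerDomain w)).getLast?) := by
  cases h <;> try (rename_i hn; obtain ⟨f, rfl, hf⟩ := NotifyOne.eq_or hn)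
  case attemptShared k hpc ht hk hv => right; simp [hv]
  case attemptWorker k y hpc ht hk hv =>
    right
    simp only [hv, reduceCtorEq, false_imp_iff, true_and, Option.some.injEq]
    refine ⟨by simp, fun x hx => ?_⟩
    subst hx
    simp
  all_goals left; simp

theorem attempts_of_stealing (h : WorkerStep S v w s s') (hw : s.Stealing S w) :
    s'.attempts w = s.attempts w + 1 := by
  obtain ⟨k, hk, hp, ht⟩ := hw
  cases h <;> try (rename_i hn; obtain ⟨f, rfl, hf⟩ := NotifyOne.eq_or hn)
  case exploreFail k' hpc ht' hk' =>
    obtain rfl : k = k' := by simpa [hp] using hpc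
    omega
  all_goals simp_all

theorem queue_of_push (h : WorkerStep S v w s s') {x : T} {l : List T} (hp : s.pc w = .push x l) :
    s'.queue w (S.graph.domain x) ≠ [] := by
  cases h <;> try (rename_i hn; obtain ⟨f, rfl, hf⟩ := NotifyOne.eq_or hn)
  case push y l' hpc =>
    obtain ⟨rfl, rfl⟩ : x = y ∧ l = l' := by simpa [hp] using hpc
    simp
  all_goals simp_all

end WorkerStep

/-- A fair run without stop signal whose victims are well distributed. -/
structure GoodRun (S : System W D T) (v : W → ℕ → Option W) (s : ℕ → State W D T)
    (θ : ℕ → Option (Thread W)) : Prop where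
  run : IsRun S v s θ
  fair : IsFair S v s θ
  noStop : ∀ n, (s n).stopSignal = false
  maxSteal : 1 ≤ S.maxSteal
  worker : ∀ t, ∃ w, S.workerDomain w = S.graph.domain t
  victim : ∀ w u, u ≠ some w → ∀ n, ∃ k ≥ n, v w k = u

namespace GoodRun

variable {s : ℕ → State W D T} {θ : ℕ → Option (Thread W)}

theorem inv (hr : GoodRun S v s θ) (n : ℕ) : (s n).Inv S := hr.run.inv hr.noStop n

theorem step (hr : GoodRun S v s θ) {n : ℕ} {w : W} (h : θ n = some (.worker w)) :
    WorkerStep S v w (s n) (s (n + 1)) := hr.run.thread n _ h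

/-- The last clause says that other threads cannot revoke a notification; thus a notified worker at
`commit` remains enabled, as weak fairness requires. -/
theorem local_congr (hr : GoodRun S v s θ) {n : ℕ} {w : W} (h : θ n ≠ some (.worker w)) :
    (s (n + 1)).pc w = (s n).pc w ∧ (s (n + 1)).task w = (s n).task w ∧
      (s (n + 1)).attempts w = (s n).attempts w ∧
      ((s n).wait w = .notified → (s (n + 1)).wait w = .notified) := by
  cases hθ : θ n with
  | none => simp [(hr.run.env n hθ).eq (hr.noStop _)]
  | some i =>
    cases i with
    | worker x =>
      have hx : w ≠ x := by rintro rfl; exact h hθ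
      have hs := hr.step hθ
      refine ⟨hs.pc_of_ne hx, hs.task_of_ne hx, hs.attempts_of_ne hx, fun hw => ?_⟩
      rcases hs.wait_of_ne hx with h' | h'
      · rw [h', hw]
      · exact h'.2
    | submitter =>
      have hs : SubmitStep S (s n) (s (n + 1)) := hr.run.thread n _ hθ
      generalize s (n + 1) = s' at hs
      cases hs with
      | push t l _ _ => exact ⟨rfl, rfl, rfl, id⟩
      | notify d s₁ _ hn =>
        obtain ⟨f, rfl, hf, -⟩ := NotifyOne.eq_or hn
        refine ⟨rfl, rfl, rfl, fun hw => ?_⟩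
        rcases hf w with h' | h'
        · exact h'.trans hw
        · exact h'.2

theorem congr_of_no_step (hr : GoodRun S v s θ) {w : W} {n m : ℕ} (hnm : n ≤ m)
    (h : ∀ k, n ≤ k → k < m → θ k ≠ some (.worker w)) :
    (s m).pc w = (s n).pc w ∧ (s m).task w = (s n).task w := by
  induction m, hnm using Nat.le_induction with
  | base => exact ⟨rfl, rfl⟩
  | succ m hnm ih =>
    obtain ⟨h1, h2⟩ := ih fun k hk hkm => h k hk (by omega)
    obtain ⟨h3, h4, -⟩ := hr.local_congr (h m hnm (by omega))
    exact ⟨h3.trans h1, h4.trans h2⟩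

theorem exists_first_step (hr : GoodRun S v s θ) {w : W} {n : ℕ}
    (h : ∃ m ≥ n, θ m = some (.worker w)) :
    ∃ m ≥ n, θ m = some (.worker w) ∧ (s m).pc w = (s n).pc w ∧ (s m).task w = (s n).task w := by
  classical
  have hm := Nat.find_spec h
  refine ⟨Nat.find h, hm.1, hm.2, hr.congr_of_no_step hm.1 fun k hk hkm hθ => ?_⟩
  exact Nat.find_min h hkm ⟨hk, hθ⟩

theorem exists_step_of_ne_commit (hr : GoodRun S v s θ) {w : W} {n : ℕ}
    (h : (s n).pc w ≠ .commit) :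
    ∃ m ≥ n, θ m = some (.worker w) ∧ (s m).pc w = (s n).pc w ∧ (s m).task w = (s n).task w := by
  refine hr.exists_first_step ?_
  by_contra! hno
  obtain ⟨m, hm, hθ⟩ := hr.fair (.worker w) n fun m hm => by
    refine WorkerStep.exists_of_ne_commit v ((hr.inv m).worker w) ?_
    rwa [(hr.congr_of_no_step hm fun k hk _ => hno k hk).1]
  exact hno m hm hθ

/-- A worker runs a task, or makes a steal attempt, or sleeps from some time on. -/
theorem worker_progress (hr : GoodRun S v s θ) (w : W) (n : ℕ) :
    (∃ m ≥ n, θ m = some (.worker w) ∧ (s m).pc w = .invoke) ∨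
    (∃ m ≥ n, θ m = some (.worker w) ∧ (s m).Stealing S w) ∨
    ∀ᶠ k in atTop, (s k).pc w = .commit ∧ (s k).wait w = .waiting := by
  -- Each own step at positive rank lowers the rank. A worker that never steps again must, by
  -- fairness, be blocked at `commit`.
  induction hk : (s n).rank S w using Nat.strong_induction_on generalizing n with
  | _ k ih =>
    subst hk
    by_cases hex : ∃ m ≥ n, θ m = some (.worker w)
    · obtain ⟨m, hm, hθ, hp, ht⟩ := hr.exists_first_step hex
      have hrank : (s m).rank S w = (s n).rank S w := by simp only [State.rank, hp, ht]
      by_cases h0 : (s m).rank S w = 0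
      · rcases invoke_or_stealing_of_rank ((hr.inv m).worker w) h0 with h' | h'
        · exact .inl ⟨m, hm, hθ, h'⟩
        · exact .inr (.inl ⟨m, hm, hθ, h'⟩)
      · have hlt := (hr.step hθ).rank_lt (hr.noStop m) hr.maxSteal ((hr.inv m).worker w) h0
        rcases ih _ (hrank ▸ hlt) (m + 1) rfl with ⟨j, hj, h'⟩ | ⟨j, hj, h'⟩ | h'
        · exact .inl ⟨j, by omega, h'⟩
        · exact .inr (.inl ⟨j, by omega, h'⟩)
        · exact .inr (.inr h')
    · push Not at hex
      have hc : (s n).pc w = .commit := by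
        by_contra hc
        obtain ⟨m, hm, hθ, -⟩ := hr.exists_step_of_ne_commit hc
        exact hex m hm hθ
      have hcm : ∀ m ≥ n, (s m).pc w = .commit := fun m hm =>
        (hr.congr_of_no_step hm fun k hk _ => hex k hk).1.trans hc
      refine .inr (.inr (eventually_atTop.2 ⟨n, fun m hm => ⟨hcm m hm, ?_⟩⟩))
      have h1 := ((hr.inv m).worker w).wait_ne (by rw [hcm m hm]; rfl)
      cases hw : (s m).wait w with
      | idle => exact absurd hw h1
      | waiting => rfl
      | notified =>
        exfalso
        have hwk : ∀ k ≥ m, (s k).wait w = .notified := fun k hk => by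
          induction k, hk using Nat.le_induction with
          | base => exact hw
          | succ k hk ih => exact (hr.local_congr (hex k (by omega))).2.2.2 ih
        obtain ⟨k, hk, hθ⟩ := hr.fair (.worker w) m fun k hk =>
          ⟨_, WorkerStep.commit (hcm k (by omega)) (hwk k hk)⟩
        exact hex k (by omega) hθ

/-- From time `n` on, no task of domain `d` is executed. -/
def _root_.WorkStealing.Starved (S : System W D T) (s : ℕ → State W D T)
    (θ : ℕ → Option (Thread W)) (d : D) (n : ℕ) : Prop :=
  ∀ m ≥ n, ∀ w, S.workerDomain w = d → θ m = some (.worker w) → (s m).pc w ≠ .invoke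

/-- A held task is given up only at `invoke`, which starvation excludes. But a worker that keeps its
task neither attempts to steal nor sleeps, contradicting `worker_progress`. -/
theorem task_eq_none (hr : GoodRun S v s θ) {d : D} {n : ℕ} (hst : Starved S s θ d n) {m : ℕ}
    (hm : n ≤ m) {w : W} (hw : S.workerDomain w = d) : (s m).task w = none := by
  by_contra ht
  have hall : ∀ k ≥ m, (s k).task w ≠ none := fun k hk => by
    induction k, hk using Nat.le_induction with
    | base => exact ht
    | succ k hk ih =>
      by_cases hθ : θ k = some (.worker w)
      · exact (hr.step hθ).task_stable ((hr.inv k).worker w) (hst k (by omega) w hw hθ) ih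
      · rwa [(hr.local_congr hθ).2.1]
  rcases hr.worker_progress w m with ⟨k, hk, hθ, hp⟩ | ⟨k, hk, hθ, j, hj, hp, h0⟩ | h
  · exact hst k (by omega) w hw hθ hp
  · exact hall k hk h0
  · obtain ⟨k, hk, hp, -⟩ := ((eventually_ge_atTop m).and h).exists
    exact hall k hk (((hr.inv k).worker w).task_eq (by rw [hp]; rfl) (by rw [hp]; rfl))

/-- A task can leave a queue for `d` only into the hands of a worker of `d`, and those hold nothing.
-/
theorem queue_ne_nil (hr : GoodRun S v s θ) {d : D} {n : ℕ} (hst : Starved S s θ d n) {x : W}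
    {m : ℕ} (hm : n ≤ m) (hq : (s m).queue x d ≠ []) {k : ℕ} (hk : m ≤ k) :
    (s k).queue x d ≠ [] := by
  induction k, hk using Nat.le_induction with
  | base => exact hq
  | succ k hk ih =>
    cases hθ : θ k with
    | none => rwa [(hr.run.env k hθ).eq (hr.noStop _)]
    | some i =>
      cases i with
      | worker w =>
        rcases (hr.step hθ).queue_ne_nil ih with h | ⟨hw, h⟩
        · exact h
        · exact absurd (hr.task_eq_none hst (by omega) hw) h
      | submitter =>
        have hs : SubmitStep S (s k) (s (k + 1)) := hr.run.thread k _ hθ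
        generalize s (k + 1) = s' at hs
        cases hs with
        | push t l _ _ => exact ih
        | notify d s₁ _ hn => obtain ⟨f, rfl, -⟩ := NotifyOne.eq_or hn; exact ih

theorem shared_ne_nil (hr : GoodRun S v s θ) {d : D} {n : ℕ} (hst : Starved S s θ d n)
    {m : ℕ} (hm : n ≤ m) (hq : (s m).shared d ≠ []) {k : ℕ} (hk : m ≤ k) :
    (s k).shared d ≠ [] := by
  induction k, hk using Nat.le_induction with
  | base => exact hq
  | succ k hk ih =>
    cases hθ : θ k with
    | none => rwa [(hr.run.env k hθ).eq (hr.noStop _)]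
    | some i =>
      cases i with
      | worker w =>
        rcases (hr.step hθ).shared_ne_nil ih with h | ⟨hw, h⟩
        · exact h
        · exact absurd (hr.task_eq_none hst (by omega) hw) h
      | submitter =>
        have hs : SubmitStep S (s k) (s (k + 1)) := hr.run.thread k _ hθ
        generalize s (k + 1) = s' at hs
        cases hs with
        | push t l _ _ =>
          by_cases hd : d = S.graph.domain t
          · subst hd; simp
          · simpa [hd] using ih
        | notify d s₁ _ hn => obtain ⟨f, rfl, -⟩ := NotifyOne.eq_or hn; exact ih

theorem attempts_le_succ (hr : GoodRun S v s θ) (w : W) (n : ℕ) :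
    (s n).attempts w ≤ (s (n + 1)).attempts w := by
  by_cases hθ : θ n = some (.worker w)
  · rcases (hr.step hθ).attempts_eq_or with h | h <;> omega
  · exact (hr.local_congr hθ).2.2.1.ge

/-- If a starving domain cannot steal from some victim, then its workers fall asleep. -/
theorem eventually_commit (hr : GoodRun S v s θ) {d : D} {n : ℕ} (hst : Starved S s θ d n) {w : W}
    (hw : S.workerDomain w = d) {u : Option W} (hu : u ≠ some w)
    (huv : ∀ m ≥ n, θ m = some (.worker w) → v w ((s m).attempts w) = u →
      (s (m + 1)).attempts w = (s m).attempts w) :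
    ∀ᶠ k in atTop, (s k).pc w = .commit ∧ (s k).wait w = .waiting := by
  classical
  by_contra hno
  have hmono : Monotone fun m => (s m).attempts w :=
    monotone_nat_of_le_succ (hr.attempts_le_succ w)
  have hsteal : ∀ m ≥ n, ∃ k ≥ m, (s k).attempts w < (s (k + 1)).attempts w := by
    intro m hm
    rcases hr.worker_progress w m with ⟨k, hk, hθ, hp⟩ | ⟨k, hk, hθ, h⟩ | h
    · exact absurd hp (hst k (by omega) w hw hθ)
    · exact ⟨k, hk, by rw [(hr.step hθ).attempts_of_stealing h]; omega⟩
    · exact absurd h hno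
  have hunb : ∀ b, ∃ m ≥ n, b < (s m).attempts w := by
    intro b
    induction b with
    | zero =>
      obtain ⟨k, hk, h⟩ := hsteal n le_rfl
      exact ⟨k + 1, by omega, by omega⟩
    | succ b ih =>
      obtain ⟨m, hm, hb⟩ := ih
      obtain ⟨k, hk, h⟩ := hsteal m hm
      have : (s m).attempts w ≤ (s k).attempts w := hmono hk
      exact ⟨k + 1, by omega, by omega⟩
  -- `b` is a position of the random sequence, unused at time `n`, at which the victim is `u`. The
  -- attempt count is unbounded and grows by single units, so the step at which it first exceeds `b`
  -- is attempt number `b`, and `huv` forbids that attempt.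
  obtain ⟨b, hb, hvb⟩ := hr.victim w u hu ((s n).attempts w)
  have hex : ∃ m, b < (s m).attempts w := let ⟨m, _, h⟩ := hunb b; ⟨m, h⟩
  have hfind := Nat.find_spec hex
  have hn : n < Nat.find hex := by
    by_contra! hle
    have : (s (Nat.find hex)).attempts w ≤ (s n).attempts w := hmono hle
    omega
  obtain ⟨m, hm⟩ : ∃ m, Nat.find hex = m + 1 := ⟨Nat.find hex - 1, by omega⟩
  rw [hm] at hfind hn
  have hmb : (s m).attempts w ≤ b := not_lt.1 (Nat.find_min hex (m := m) (by omega))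
  have hθ : θ m = some (.worker w) := by
    by_contra hθ
    have := (hr.local_congr hθ).2.2.1
    omega
  rcases (hr.step hθ).attempts_eq_or with h | ⟨h, -⟩
  · omega
  · have hmb' : (s m).attempts w = b := by omega
    have := huv m (by omega) hθ (by rw [hmb', hvb])
    omega

/-- A nonempty shared queue is a victim that cannot be robbed under starvation, so all workers of
`d` fall asleep. By the invariant the submitter then owes a notification forever, although fairness
makes it send one. -/
theorem shared_eq_nil (hr : GoodRun S v s θ) {d : D} (hd : ∃ w, S.workerDomain w = d) {n : ℕ}
    (hst : Starved S s θ d n) {m : ℕ} (hm : n ≤ m) : (s m).shared d = [] := by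
  by_contra hq
  have hqk : ∀ k ≥ m, (s k).shared d ≠ [] := fun k hk => hr.shared_ne_nil hst hm hq hk
  have hst' : Starved S s θ d m := fun k hk => hst k (by omega)
  have hall : ∀ w, ∀ᶠ k in atTop, S.workerDomain w = d →
      (s k).pc w = .commit ∧ (s k).wait w = .waiting := by
    intro w
    by_cases hw : S.workerDomain w = d
    · refine (hr.eventually_commit hst' hw (u := none) (by simp) fun k hk hθ hv => ?_).mono
        fun k h _ => h
      rcases (hr.step hθ).attempts_eq_or with h | ⟨-, h, -⟩
      · exact h
      · have h0 := hr.task_eq_none hst' (m := k + 1) (by omega) hw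
        rw [h hv, hw] at h0
        exact absurd (List.getLast?_eq_none_iff.1 h0) (hqk k hk)
    · exact .of_forall fun k h => absurd h hw
  obtain ⟨N, hN⟩ := eventually_atTop.1 ((eventually_all.2 hall).and (eventually_ge_atTop m))
  have hnot : ∀ k ≥ N, (s k).toNotify = some d := by
    intro k hk
    rcases (hr.inv k).shared d hd (hqk k (hN k hk).2) with h | ⟨a, had, ha⟩
    · exact h
    · obtain ⟨h1, h2⟩ := (hN k hk).1 a had
      exact absurd ⟨h2, by rw [h1]; trivial⟩ ha
  obtain ⟨k, hk, hθ⟩ := hr.fair .submitter N fun k hk => by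
    obtain ⟨s₁, h⟩ := NotifyOne.exists S d (s k)
    exact ⟨_, SubmitStep.notify d s₁ (hnot k hk) h⟩
  have hs : SubmitStep S (s k) (s (k + 1)) := hr.run.thread k _ hθ
  have h1 := hnot k hk
  have h2 := hnot (k + 1) (by omega)
  generalize s (k + 1) = s' at hs h2
  cases hs with
  | push t l _ hn => simp [h1] at hn
  | notify d s₁ _ hn => simp at h2

theorem queue_eq_nil (hr : GoodRun S v s θ) {d : D} (hd : ∃ w, S.workerDomain w = d) {n : ℕ}
    (hst : Starved S s θ d n) {m : ℕ} (hm : n ≤ m) (x : W) : (s m).queue x d = [] := by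
  by_contra hq
  have hqk : ∀ k ≥ m, (s k).queue x d ≠ [] := fun k hk => hr.queue_ne_nil hst hm hq hk
  have hst' : Starved S s θ d m := fun k hk => hst k (by omega)
  by_cases hxd : S.workerDomain x = d
  -- In its own domain, the owner stays in the exploit loop and so must arrive at `invoke`.
  · have hbusy : ∀ k ≥ m, ((s k).pc x).busy = true := fun k hk =>
      ((hr.inv k).worker x).busy (by rw [hxd]; exact hqk k hk)
    rcases hr.worker_progress x m with ⟨k, hk, hθ, hp⟩ | ⟨k, hk, hθ, j, hj, hp, h0⟩ | h
    · exact hst' k hk x hxd hθ hp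
    · simpa [hp, PC.busy] using hbusy k hk
    · obtain ⟨k, hk, hp, -⟩ := ((eventually_ge_atTop m).and h).exists
      simpa [hp, PC.busy] using hbusy k hk
  have hall : ∀ w, ∀ᶠ k in atTop, S.workerDomain w = d →
      (s k).pc w = .commit ∧ (s k).wait w = .waiting := by
    intro w
    by_cases hw : S.workerDomain w = d
    -- The owner has another domain than the thief, so it is an admissible victim.
    · have hne : some x ≠ some w := by
        rintro h
        obtain rfl := Option.some.inj h
        exact hxd hw
      refine (hr.eventually_commit hst' hw (u := some x) hne fun k hk hθ hv => ?_).mono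
        fun k h _ => h
      rcases (hr.step hθ).attempts_eq_or with h | ⟨-, -, h⟩
      · exact h
      · have h0 := hr.task_eq_none hst' (m := k + 1) (by omega) hw
        rw [h x hv, hw] at h0
        exact absurd (List.getLast?_eq_none_iff.1 h0) (hqk k hk)
    · exact .of_forall fun k h => absurd h hw
  obtain ⟨N, hN⟩ := eventually_atTop.1 ((eventually_all.2 hall).and (eventually_ge_atTop m))
  have hpend : ∀ k ≥ N, ((s k).pc x).pending d := by
    intro k hk
    rcases (hr.inv k).queue x d hd hxd (hqk k (hN k hk).2) with h | ⟨a, had, ha⟩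
    · exact h
    · obtain ⟨h1, h2⟩ := (hN k hk).1 a had
      exact absurd ⟨h2, by rw [h1]; trivial⟩ ha
  -- The owner would remain at the notification tests forever, but none of the three outcomes of
  -- `worker_progress` is at such a location.
  rcases hr.worker_progress x N with ⟨k, hk, hθ, hp⟩ | ⟨k, hk, hθ, j, hj, hp, h0⟩ | h
  · simpa [hp, PC.pending] using hpend k hk
  · simpa [hp, PC.pending] using hpend k hk
  · obtain ⟨k, hk, hp, -⟩ := ((eventually_ge_atTop N).and h).exists
    simpa [hp, PC.pending] using hpend k hk

theorem exists_shared_of_toSubmit (hr : GoodRun S v s θ) {t : T} {n : ℕ}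
    (ht : t ∈ (s n).toSubmit) : ∃ m ≥ n, (s m).shared (S.graph.domain t) ≠ [] := by
  classical
  -- Each task costs the submitter a push and a notification: a push lowers this measure by two and
  -- raises it by one, a notification lowers it by one.
  induction hk : 2 * (s n).toSubmit.length + (if (s n).toNotify = none then 0 else 1)
    using Nat.strong_induction_on generalizing n with
  | _ k ih =>
    subst hk
    have hcongr : ∀ m, θ m ≠ some .submitter →
        (s (m + 1)).toSubmit = (s m).toSubmit ∧ (s (m + 1)).toNotify = (s m).toNotify := by
      intro m hm
      cases hθ : θ m with
      | none => simp [(hr.run.env m hθ).eq (hr.noStop _)]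
      | some i =>
        cases i with
        | worker w => exact ⟨(hr.step hθ).toSubmit_eq, (hr.step hθ).toNotify_eq⟩
        | submitter => exact absurd hθ hm
    have hcongr' : ∀ m ≥ n, (∀ k, n ≤ k → k < m → θ k ≠ some .submitter) →
        (s m).toSubmit = (s n).toSubmit ∧ (s m).toNotify = (s n).toNotify := by
      intro m hm h
      induction m, hm using Nat.le_induction with
      | base => exact ⟨rfl, rfl⟩
      | succ m hm ihm =>
        obtain ⟨h1, h2⟩ := ihm fun k hk hkm => h k hk (by omega)
        obtain ⟨h3, h4⟩ := hcongr m (h m hm (by omega))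
        exact ⟨h3.trans h1, h4.trans h2⟩
    have hex : ∃ m, n ≤ m ∧ θ m = some .submitter := by
      by_contra! hno
      obtain ⟨m, hm, hθ⟩ := hr.fair .submitter n fun m hm => by
        obtain ⟨h1, h2⟩ := hcongr' m hm fun k hk _ => hno k hk
        cases hn : (s m).toNotify with
        | none =>
          obtain ⟨u, l, hul⟩ := List.exists_cons_of_ne_nil (List.ne_nil_of_mem (h1 ▸ ht))
          exact ⟨_, SubmitStep.push u l hul hn⟩
        | some d =>
          obtain ⟨s₁, h⟩ := NotifyOne.exists S d (s m)
          exact ⟨_, SubmitStep.notify d s₁ hn h⟩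
      exact hno m hm hθ
    obtain ⟨hm, hθ⟩ := Nat.find_spec hex
    obtain ⟨h1, h2⟩ := hcongr' _ hm fun k hk hkm h => Nat.find_min hex hkm ⟨hk, h⟩
    generalize Nat.find hex = m at hm hθ h1 h2
    have hs : SubmitStep S (s m) (s (m + 1)) := hr.run.thread m _ hθ
    have key : (s (m + 1)).shared (S.graph.domain t) ≠ [] ∨ t ∈ (s (m + 1)).toSubmit ∧
        2 * (s (m + 1)).toSubmit.length + (if (s (m + 1)).toNotify = none then 0 else 1) <
          2 * (s n).toSubmit.length + (if (s n).toNotify = none then 0 else 1) := by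
      rw [← h1, ← h2]
      rw [← h1] at ht
      generalize s (m + 1) = s' at hs
      cases hs with
      | push u l hu hn =>
        rw [hu, List.mem_cons] at ht
        rcases ht with rfl | ht
        · left; simp
        · right
          refine ⟨ht, ?_⟩
          simp [hu, hn]
          omega
      | notify d s₁ hd hn =>
        obtain ⟨f, rfl, -⟩ := NotifyOne.eq_or hn
        right
        exact ⟨ht, by simp [hd]⟩
    rcases key with h | ⟨h, hlt⟩
    · exact ⟨m + 1, by omega, h⟩
    · obtain ⟨j, hj, h'⟩ := ih _ hlt h rfl
      exact ⟨j, by omega, h'⟩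

/-- A ready task is in one of five places. Tasks still to be submitted or about to be pushed reach a
queue by fairness; queues and hands are empty under starvation. -/
theorem not_starved (hr : GoodRun S v s θ) {n : ℕ} {t : T} (ht : t ∈ (s n).toTaskState.ready) :
    ¬ Starved S s θ (S.graph.domain t) n := by
  intro hst
  have hd := hr.worker t
  simp only [State.toTaskState, Multiset.mem_add, Multiset.mem_sum, Finset.mem_univ, true_and,
    Multiset.mem_coe] at ht
  rcases ht with (((h | ⟨d, h⟩) | ⟨x, d, h⟩) | ⟨w, h⟩) | ⟨w, h⟩
  · obtain ⟨m, hm, hq⟩ := hr.exists_shared_of_toSubmit h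
    exact hq (hr.shared_eq_nil hd hst hm)
  · obtain rfl := (hr.inv n).domain_shared d t h
    exact List.ne_nil_of_mem h (hr.shared_eq_nil hd hst le_rfl)
  · obtain rfl := (hr.inv n).domain_queue x d t h
    exact List.ne_nil_of_mem h (hr.queue_eq_nil hd hst le_rfl x)
  · cases hw : (s n).task w with
    | none => simp [hw] at h
    | some u =>
      obtain rfl : t = u := by simpa [hw] using h
      have := hr.task_eq_none hst le_rfl ((hr.inv n).domain_task w t hw).symm
      simp [hw] at this
  · cases hp : (s n).pc w with
    | push y l =>
      obtain rfl : t = y := by simpa [hp, PC.pushing] using h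
      obtain ⟨m, hm, hθ, hpm, -⟩ := hr.exists_step_of_ne_commit (w := w) (n := n) (by simp [hp])
      exact (hr.step hθ).queue_of_push (hpm.trans hp) (hr.queue_eq_nil hd hst (by omega) w)
    | _ => simp [hp, PC.pushing] at h

theorem follows (hr : GoodRun S v s θ) : Follows S.graph fun n => (s n).toTaskState :=
  hr.run.follows hr.noStop

theorem executed_lt_of_invoke (hr : GoodRun S v s θ) {m : ℕ} {w : W}
    (hθ : θ m = some (.worker w)) (hp : (s m).pc w = .invoke) :
    ∃ t, S.graph.domain t = S.workerDomain w ∧ (s m).executed t < (s (m + 1)).executed t := by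
  obtain ⟨t, ht, he⟩ := (hr.step hθ).executed_of_invoke hp
  exact ⟨t, (hr.inv m).domain_task w t ht, by omega⟩

theorem exists_executed (hr : GoodRun S v s θ) {n : ℕ} {t : T}
    (ht : t ∈ (s n).toTaskState.ready) :
    ∃ m ≥ n, ∃ t', S.graph.domain t' = S.graph.domain t ∧
      (s n).executed t' < (s m).executed t' := by
  have h := hr.not_starved ht
  unfold Starved at h
  push Not at h
  obtain ⟨m, hm, w, hw, hθ, hp⟩ := h
  obtain ⟨t', ht', hlt⟩ := hr.executed_lt_of_invoke hθ hp
  exact ⟨m + 1, by omega, t', ht'.trans hw, (hr.follows.executed_mono t' hm).trans_lt hlt⟩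

theorem _root_.WorkStealing.WorkerStep.releasing_eq_zero {s₁ s₂ : State W D T}
    (h : WorkerStep S v w s₁ s₂)
    (hp : s₁.pc w ≠ .invoke) (h0 : (s₁.pc w).releasing = 0) : (s₂.pc w).releasing = 0 := by
  cases h <;> try (rename_i hn; obtain ⟨f, rfl, hf⟩ := NotifyOne.eq_or hn)
  all_goals
    simp only [State.goto, State.setTask, State.setWait, State.setQueue, State.setShared,
      State.addActives, State.addThieves, State.notifyAll, Function.update_self,
      apply_ite PC.releasing]
    simp_all [PC.releasing]

theorem eventually_executed_eq (hr : GoodRun S v s θ) (hB : ∃ B, ∀ n t, (s n).executed t ≤ B) :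
    ∃ N, ∀ n ≥ N, ∀ t, (s n).executed t = (s N).executed t := by
  obtain ⟨B, hB⟩ := hB
  have h : ∀ t, ∀ᶠ N in atTop, ∀ n ≥ N, (s n).executed t = (s N).executed t := by
    intro t
    have hbdd : BddAbove (Set.range fun n => (s n).executed t) :=
      ⟨B, by rintro _ ⟨n, rfl⟩; exact hB n t⟩
    obtain ⟨N, hN⟩ := Nat.sSup_mem (Set.range_nonempty _) hbdd
    have hle : ∀ n, (s n).executed t ≤ (s N).executed t := fun n =>
      (le_csSup hbdd ⟨n, rfl⟩).trans hN.ge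
    have heq : ∀ n ≥ N, (s n).executed t = (s N).executed t := fun n hn =>
      (hle n).antisymm (hr.follows.executed_mono t hn)
    exact eventually_atTop.2 ⟨N, fun m hm n hn => (heq n (by omega)).trans (heq m hm).symm⟩
  obtain ⟨N, hN⟩ := (eventually_all.2 h).exists
  exact ⟨N, fun n hn t => hN t n hn⟩

/-- Bounded execution counts become constant. From then on a ready task would force another
execution, and since no callable runs, each worker finishes its current list of successors and never
gets a new one. -/
theorem eventually_complete (hr : GoodRun S v s θ) (hB : ∃ B, ∀ n t, (s n).executed t ≤ B) :
    ∃ N, ∀ n ≥ N, (s n).toTaskState.Complete := by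
  obtain ⟨N, hN⟩ := hr.eventually_executed_eq hB
  have hready : ∀ n ≥ N, (s n).toTaskState.ready = 0 := by
    intro n hn
    refine Multiset.eq_zero_of_forall_notMem fun t ht => ?_
    obtain ⟨m, hm, t', -, hlt⟩ := hr.exists_executed ht
    rw [hN m (by omega), hN n hn] at hlt
    exact lt_irrefl _ hlt
  have hinvoke : ∀ n ≥ N, ∀ w, θ n = some (.worker w) → (s n).pc w ≠ .invoke := by
    intro n hn w hθ hp
    obtain ⟨t, -, hlt⟩ := hr.executed_lt_of_invoke hθ hp
    rw [hN (n + 1) (by omega), hN n hn] at hlt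
    exact lt_irrefl _ hlt
  have hrel : ∀ w, ∀ᶠ n in atTop, ((s n).pc w).releasing = 0 := by
    intro w
    have hex : ∃ m ≥ N, ((s m).pc w).releasing = 0 := by
      rcases hr.worker_progress w N with ⟨k, hk, hθ, hp⟩ | ⟨k, hk, hθ, j, hj, hp, h0⟩ | h
      · exact absurd hp (hinvoke k hk w hθ)
      · exact ⟨k, hk, by rw [hp]; rfl⟩
      · obtain ⟨k, hk, hp, -⟩ := ((eventually_ge_atTop N).and h).exists
        exact ⟨k, hk, by rw [hp]; rfl⟩
    obtain ⟨m, hm, h0⟩ := hex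
    refine eventually_atTop.2 ⟨m, fun n hn => ?_⟩
    induction n, hn using Nat.le_induction with
    | base => exact h0
    | succ n hn ih =>
      by_cases hθ : θ n = some (.worker w)
      · exact (hr.step hθ).releasing_eq_zero (hinvoke n (by omega) w hθ) ih
      · rwa [(hr.local_congr hθ).1]
  obtain ⟨M, hM⟩ := eventually_atTop.1 ((eventually_all.2 hrel).and (eventually_ge_atTop N))
  exact ⟨M, fun n hn => ⟨hready n (hM n hn).2, Finset.sum_eq_zero fun w _ => (hM n hn).1 w⟩⟩

end GoodRun

end Liveness

/-! ### Random victims: Borel–Cantelli, and the theorem. -/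

/-- Almost surely, every worker attempts to steal from each possible victim infinitely often. -/
theorem RandomVictims.ae_frequently {W : Type*} [Fintype W] {Ω : Type*} [MeasurableSpace Ω]
    {P : Measure Ω} [IsProbabilityMeasure P] {V : W → ℕ → Ω → Option W}
    (hV : RandomVictims P V) :
    ∀ᵐ ω ∂P, ∀ w u, u ≠ some w → ∀ n, ∃ k ≥ n, V w k ω = u := by
  refine ae_all_iff.2 fun w => ae_all_iff.2 fun u => ?_
  by_cases hu : u = some w
  · exact .of_forall fun ω h => absurd hu h
  have hmeas : ∀ k, MeasurableSet {ω | V w k ω = u} := fun k =>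
    hV.measurable w k (t := {u}) trivial
  have hind : iIndepSet (fun k => {ω | V w k ω = u}) P := by
    rw [iIndepSet_iff_meas_biInter hmeas]
    intro F
    exact (hV.indep w).measure_inter_preimage_eq_mul (m := fun _ => ⊤) F (sets := fun _ => {u})
      fun _ _ => trivial
  have hsum : ∑' k, P {ω | V w k ω = u} = ⊤ := by
    simp only [hV.uniform w _ u hu]
    -- The constant probability is nonzero because there are finitely many workers.
    exact ENNReal.tsum_const_eq_top_of_ne_zero (by simp)
  have h1 := measure_limsup_eq_one hmeas hind hsum
  have h2 : ∀ᵐ ω ∂P, ω ∈ Filter.limsup (fun k => {ω | V w k ω = u}) Filter.atTop := by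
    rw [← prob_compl_eq_zero_iff (MeasurableSet.measurableSet_limsup hmeas)] at h1
    exact h1
  filter_upwards [h2] with ω hω _ n
  rw [Filter.mem_limsup_iff_frequently_mem, Filter.frequently_atTop] at hω
  exact hω n

end WorkStealing

theorem mainTheorem2 {W D T : Type*} [Fintype W] [DecidableEq W] [Fintype D] [DecidableEq D]
    [Fintype T] [DecidableEq T] (S : WorkStealing.System W D T)
    (hsteal : 1 ≤ S.maxSteal)
    (hworker : ∀ t, ∃ w, S.workerDomain w = S.graph.domain t)
    {Ω : Type*} [MeasurableSpace Ω] (P : Measure Ω) [IsProbabilityMeasure P]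
    (V : W → ℕ → Ω → Option W) (hV : WorkStealing.RandomVictims P V) :
    ∀ᵐ ω ∂P, ∀ (s : ℕ → WorkStealing.State W D T) (θ : ℕ → Option (WorkStealing.Thread W)),
      WorkStealing.IsRun S (fun w k => V w k ω) s θ →
      WorkStealing.IsFair S (fun w k => V w k ω) s θ →
      (∀ n, (s n).stopSignal = false) →
      -- the run follows the task-level scheduling of the graph
      ((s 0).toTaskState = WorkStealing.TaskState.init S.graph ∧
        ∀ n, (s (n + 1)).toTaskState = (s n).toTaskState ∨
          WorkStealing.TaskStep S.graph (s n).toTaskState (s (n + 1)).toTaskState) ∧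
      -- no undetected task parallelism, in any domain
      (∀ n, ∀ t ∈ (s n).toTaskState.ready, ∃ m ≥ n, ∃ t',
        S.graph.domain t' = S.graph.domain t ∧ (s n).executed t' < (s m).executed t') ∧
      -- if the control flow is finite, every submitted task is eventually executed, and the
      -- execution of the graph is completed
      ((∃ B, ∀ n t, (s n).executed t ≤ B) →
        (∀ n t, ∃ m ≥ n,
          (s n).executed t + (s n).toTaskState.ready.count t ≤ (s m).executed t) ∧
        ∃ N, ∀ n ≥ N, (s n).toTaskState.Complete) ∧
      -- the control flow is finite if every cycle contains a condition task and the condition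
      -- tasks are executed finitely often
      (S.graph.StronglyAcyclic →
        (∃ B, ∀ n t, S.graph.isCond t = true → (s n).executed t ≤ B) →
        ∃ B, ∀ n t, (s n).executed t ≤ B) ∧
      -- an acyclic graph without condition tasks is executed in the order of its dependencies, and
      -- eventually each of its tasks has been executed exactly once
      (S.graph.StronglyAcyclic → (∀ t, S.graph.isCond t = false) →
        (∀ n p t, t ∈ S.graph.succ p → (s n).executed t ≤ (s n).executed p) ∧
        ∃ N, ∀ n ≥ N, ∀ t, (s n).executed t = 1) := by
  -- The exceptional null set is fixed before the run is chosen; the remaining argument is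
  -- deterministic.
  filter_upwards [hV.ae_frequently] with ω hω s θ hrun hfair hnoStop
  have hr : WorkStealing.GoodRun S (fun w k => V w k ω) s θ :=
    ⟨hrun, hfair, hnoStop, hsteal, hworker, hω⟩
  have hf := hr.follows
  refine ⟨⟨hf.init, hf.step⟩, fun n t ht => hr.exists_executed ht, fun hB => ?_,
    fun hg hB => hf.bounded_of_bounded_cond hg hB, fun hg hc => ?_⟩
  · obtain ⟨N, hN⟩ := hr.eventually_complete hB
    -- Executions plus ready copies never decrease, and after `N` no ready copy is left.
    refine ⟨fun n t => ⟨max n N, le_max_left n N, ?_⟩, N, hN⟩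
    have h := hf.executed_add_count_mono t (le_max_left n N)
    simp only [(hN (max n N) (le_max_right n N)).1, Multiset.count_zero, add_zero] at h
    exact h
  · have hone : ∀ n t, (s n).executed t ≤ 1 := fun n t => by
      obtain ⟨r, h⟩ := hf.exists_once hc n
      exact (Nat.le_add_right _ _).trans (h.le_one t)
    refine ⟨fun n p t hpt => ?_, ?_⟩
    · obtain ⟨r, h⟩ := hf.exists_once hc n
      exact h.executed_le hc hpt
    · obtain ⟨N, hN⟩ := hr.eventually_complete ⟨1, hone⟩
      refine ⟨N, fun n hn t => ?_⟩
      obtain ⟨r, h⟩ := hf.exists_once hc n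
      exact h.executed_eq_one hc hg (hN n hn) t
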